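/- **Notation.** $e_1,e_2,e_3$ is the standard basis of $\mathbb R^3$, $S(a)b=a\times b$, and $\lambda_{\min},\lambda_{\max}$ are the extreme eigenvalues of a symmetric matrix. For $\omega\in\mathbb R^3$, $$[\omega]^\wedge=\begin{pmatrix} i\omega_3&-\omega_2+i\omega_1\\ \omega_2+i\omega_1&-i\omega_3\end{pmatrix}\in\mathfrak{su}(2),$$ and $[\cdot]^\vee$ is the inverse map. Each $X\in SU(2)$ represents the rotation matrix $R\in SO(3)$ given by $Rb=[X[b]^\wedge X^*]^\vee$. Put $\Gamma(X_1,X_2)=\tfrac12\operatorname{tr}(I-X_1^*X_2)$. **Dynamics.** Let $m,g>0$ and let $J\in\mathbb R^{3\times3}$ be symmetric positive definite. The UAV state $(p,v,X,\omega)\in\mathbb R^3\times\mathbb R^3\times SU(2)\times\mathbb R^3$ satisfies $$\dot p=v,\quad m\dot v=fRe_3-mge_3,\quad \dot X=X[\omega/2]^\wedge,\quad J\dot\omega=S(J\omega)\omega+\tau,$$ and the reference $(p_r,v_r,X_r,\omega_r)$ satisfies the same equations with inputs $(f_r,\tau_r)$. Let $e_p=p-p_r$, $e_v=v-v_r$ and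 $$f_d=-k_pe_p-k_ve_v+mge_3+m\ddot p_r .$$ **Desired attitude.** Put $b_{d3}=f_d/\|f_d\|$. The desired rotation is $R_d=[\,b_{d1},\ b_{d3}\times b_{d1},\ b_{d3}\,]$, where either (i) $b_{d1}(t)$ is an explicitly given unit vector orthogonal to $b_{d3}$, or (ii) $b_{d1}=-\dfrac{b_{d3}\times(b_{d3}\times b_{r1})}{\|b_{d3}\times b_{r1}\|}$ with $b_{r1}=R_re_1$; or else (iii) $R_d$ is the rotation represented by $\exp([\beta n/2]^\wedge)\exp([\psi_re_3/2]^\wedge)$, where $\beta=\operatorname{atan2}\big(\sqrt{f_{d1}^2+f_{d2}^2},f_{d3}\big)$, $n=(f_{d1}^2+f_{d2}^2)^{-1/2}(-f_{d2},f_{d1},0)^\top$, and $\psi_r(t)$ is a given angle. Further, $X_d(t)\in SU(2)$ is a time-continuous representative of $R_d(t)$, $\omega_d\in\mathbb R^3$ is defined by $S(\omega_d)=R_d^\top\dot R_d$, and $\dot\omega_d$ is its time derivative. **Feedback.** With $X_e=X_d^*X$ let $$e_X=\tfrac12\big[X_e-\tfrac12\operatorname{tr}(X_e)I\big]^\vee,\qquad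 e_\omega=\omega-\big[X_e^*[\omega_d]^\wedge X_e\big]^\vee .$$ The thrust is $f=f_d\cdot Re_3$ and the torque is $$\tau=-k_Xe_X-k_\omega e_\omega-S(J\omega)\omega+J\Big[-[e_\omega/2]^\wedge X_e^*[\omega_d]^\wedge X_e+X_e^*[\dot\omega_d]^\wedge X_e+X_e^*[\omega_d]^\wedge X_e[e_\omega/2]^\wedge\Big]^\vee .$$ **Gain matrices.** For $k_p,k_v,k_X,k_\omega,c_a,c_p>0$, $B_p>0$, a constant $B_f$, $\phi<\tfrac18$ and $\alpha=2\sqrt{2\phi}$, let $$W^{aa}=\begin{bmatrix}\frac{c_ak_X}{\lambda_{\max}(J)}&-\frac{c_ak_\omega}{2\lambda_{\min}(J)}\\ -\frac{c_ak_\omega}{2\lambda_{\min}(J)}&k_\omega-\frac{c_a}4\end{bmatrix},\quad M_1^{aa}=\tfrac12\begin{bmatrix}4k_X&-c_a\\-c_a&\lambda_{\min}(J)\end{bmatrix},\quad M_2^{aa}=\tfrac12\begin{bmatrix}\frac{8k_X}{2-\phi}&c_a\\c_a&\lambda_{\max}(J)\end{bmatrix},$$ $$W^{pp}=\begin{bmatrix}\frac{c_pk_p}m(1-\alpha)&-\frac{c_pk_v}{2m}(1+\alpha)\\-\frac{c_pk_v}{2m}(1+\alpha)&k_v(1-\alpha)-c_p\end{bmatrix},\quad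 M_1^{pp}=\tfrac12\begin{bmatrix}k_p&-c_p\\-c_p&m\end{bmatrix},\quad M_2^{pp}=\tfrac12\begin{bmatrix}k_p&c_p\\c_p&m\end{bmatrix},$$ $$W^{pa}=4\begin{bmatrix}\frac{B_fc_p}m&0\\B_f+k_pB_p&0\end{bmatrix}.$$ **Assumptions.** Suppose that - (A1) for all $t\ge t_0$ the desired reference $(X_d,\omega_d,\dot\omega_d)$ is well defined (no denominator above vanishes, $R_d$ is twice differentiable, and $X_d$ is continuous); - (A2) $\|mge_3+m\ddot p_r(t)\|\le B_f$ for all $t\ge t_0$; - (A3) $\|e_p(t_0)\|<B_p$; - (A4) $\Gamma(X_d(t_0),X(t_0))\le\phi<\tfrac18$; - (A5) $W^{aa},M_1^{aa},M_2^{aa},M_1^{pp},M_2^{pp},W^{pp}$ are positive definite and $B_z=4\lambda_{\min}(W^{aa})\lambda_{\min}(W^{pp})-\|W^{pa}\|^2>0$, with the matrix norm induced by the two-norm. **Claim.** The origin $(e_p,e_v,e_X,e_\omega)=0$ is uniformly exponentially stable on the domain $D$ of initial errors given by $$\Gamma(X_d(t_0),X(t_0))=\phi_\circ\le\phi,\qquad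 \|e_\omega(t_0)\|^2\le\tfrac{2}{\lambda_{\max}(J)}k_X(\phi-\phi_\circ),$$ $$\lambda_{\max}(M_2^{aa})\big(\|e_X(t_0)\|^2+\|e_\omega(t_0)\|^2\big)+\lambda_{\max}(M_2^{pp})\big(\|e_p(t_0)\|^2+\|e_v(t_0)\|^2\big)\le\tfrac12k_pB_p^2 .$$ That is, there are $C,\gamma>0$, depending only on $m,g,J$, the controller parameters, $\phi$, $B_f$ and $B_p$, such that every closed-loop solution on an interval $[t_0,T)$, $t_0<T\le\infty$, which satisfies (A1) and (A2) on that interval and starts in $D$ with (A3), satisfies $$\|e(t)\|\le C\,e^{-\gamma(t-t_0)}\|e(t_0)\|\qquad(t_0\le t<T),\qquad e=(e_p,e_v,e_X,e_\omega)\in\mathbb R^{12}.$$ -/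

import Mathlib

namespace SU2UAV

open scoped Matrix

/-! ### Vectors, matrices, eigenvalues -/

/-- Three-dimensional Euclidean space. -/
abbrev E3 := EuclideanSpace ℝ (Fin 3)

/-- Complex `2 × 2` matrices. -/
abbrev Mat2 := Matrix (Fin 2) (Fin 2) ℂ

/-- Real `3 × 3` matrices. -/
abbrev Mat3 := Matrix (Fin 3) (Fin 3) ℝ

/-- The special unitary group of degree two. -/
abbrev SU2 := Matrix.specialUnitaryGroup (Fin 2) ℂ

/-- The standard basis vectors of `ℝ³` (indexed from `0`). -/
noncomputable def basisVec (i : Fin 3) : E3 := EuclideanSpace.single i 1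

/-- A real `3 × 3` matrix applied to a vector. -/
noncomputable def act (A : Mat3) (x : E3) : E3 := WithLp.toLp 2 (A *ᵥ x.ofLp)

/-- The cross-product matrix `S(a)`, so that `S(a) b = a × b`. -/
def crossMat (a : E3) : Mat3 :=
  !![0, -a 2, a 1;
     a 2, 0, -a 0;
     -a 1, a 0, 0]

/-- The cross product `a × b = S(a) b`. -/
noncomputable def cross (a b : E3) : E3 := act (crossMat a) b

/-- Smallest eigenvalue of a real symmetric matrix. -/
noncomputable def minEig {n : ℕ} (A : Matrix (Fin n) (Fin n) ℝ) : ℝ := sInf (spectrum ℝ A)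

/-- Largest eigenvalue of a real symmetric matrix. -/
noncomputable def maxEig {n : ℕ} (A : Matrix (Fin n) (Fin n) ℝ) : ℝ := sSup (spectrum ℝ A)

/-- The matrix norm induced by the two-norm of vectors. -/
noncomputable def opNorm (A : Matrix (Fin 2) (Fin 2) ℝ) : ℝ :=
  ‖Matrix.toEuclideanCLM (n := Fin 2) (𝕜 := ℝ) A‖

/-! ### Lie maps, rotations and the distance on `SU(2)` -/

/-- The vee map of `SO(3)`. -/
noncomputable def so3Vee (K : Mat3) : E3 := !₂[K 2 1, K 0 2, K 1 0]

/-- The hat map of `SU(2)`. -/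
noncomputable def su2Hat (w : E3) : Mat2 :=
  !![Complex.I * (w 2 : ℂ), -(w 1 : ℂ) + Complex.I * (w 0 : ℂ);
     (w 1 : ℂ) + Complex.I * (w 0 : ℂ), -(Complex.I * (w 2 : ℂ))]

/-- The vee map of `SU(2)`, the inverse of the hat map on the Lie algebra. -/
noncomputable def su2Vee (K : Mat2) : E3 :=
  !₂[(K 0 1 + K 1 0).im / 2, (K 1 0 - K 0 1).re / 2, (K 0 0 - K 1 1).im / 2]

/-- The exponential map of `SU(2)`, precomposed with the hat map. -/
noncomputable def su2Exp (w : E3) : Mat2 := NormedSpace.exp (su2Hat w)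

/-- The rotation matrix `R` represented by `X`, i.e. `R b = [X [b]^ X*]^∨` for all `b`. -/
noncomputable def rot (X : Mat2) : Mat3 :=
  Matrix.of fun i j => su2Vee (X * su2Hat (basisVec j) * Xᴴ) i

/-- The distance `Γ(X₁, X₂) = tr(I - X₁* X₂) / 2` (a real number on `SU(2)`). -/
noncomputable def gam (X₁ X₂ : SU2) : ℝ :=
  (1 / 2) * (Matrix.trace (1 - (X₁ : Mat2)ᴴ * (X₂ : Mat2))).re

/-! ### The UAV dynamics -/

/-- Parameters of the UAV: mass, gravitational acceleration, inertia matrix. -/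
structure Params where
  m : ℝ
  g : ℝ
  J : Mat3

/-- Position, velocity, acceleration, attitude, attitude rate and its time derivative, thrust and
torque of a UAV, as functions of time. -/
structure Motion where
  p : ℝ → E3
  v : ℝ → E3
  a : ℝ → E3
  X : ℝ → SU2
  w : ℝ → E3
  dw : ℝ → E3
  f : ℝ → ℝ
  tau : ℝ → E3

/-- The time interval `[t₀, T)`, where `T` may be `∞`. -/
def timeIco (t₀ : ℝ) (T : EReal) : Set ℝ := {t | t₀ ≤ t ∧ (t : EReal) < T}

/-- The motion `s` satisfies the UAV equations of motion on the time set `I`. Matrices are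
differentiated entrywise; at the left end point of `I` the derivatives are one-sided. -/
structure IsUAVMotion (P : Params) (I : Set ℝ) (s : Motion) : Prop where
  pos : ∀ t ∈ I, HasDerivWithinAt s.p (s.v t) I t
  vel : ∀ t ∈ I, HasDerivWithinAt s.v (s.a t) I t
  force : ∀ t ∈ I, P.m • s.a t
    = s.f t • act (rot (s.X t)) (basisVec 2) - (P.m * P.g) • basisVec 2
  att : ∀ t ∈ I, ∀ i j, HasDerivWithinAt (fun r => (s.X r : Mat2) i j)
    (((s.X t : Mat2) * su2Hat ((1 / 2 : ℝ) • s.w t)) i j) I t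
  rate : ∀ t ∈ I, HasDerivWithinAt s.w (s.dw t) I t
  torque : ∀ t ∈ I, act P.J (s.dw t) = cross (act P.J (s.w t)) (s.w t) + s.tau t

/-! ### Desired force and desired attitude -/

/-- The controller parameters. -/
structure Gains where
  kp : ℝ
  kv : ℝ
  kX : ℝ
  kw : ℝ
  ca : ℝ
  cp : ℝ

/-- Feedforward force `m g e₃ + m p̈_r`. -/
noncomputable def feedforward (P : Params) (ref : Motion) (t : ℝ) : E3 :=
  (P.m * P.g) • basisVec 2 + P.m • ref.a t

/-- Desired force `f_d = - k_p e_p - k_v e_v + m g e₃ + m p̈_r`. -/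
noncomputable def desiredForce (P : Params) (G : Gains) (ref s : Motion) (t : ℝ) : E3 :=
  -(G.kp • (s.p t - ref.p t)) - G.kv • (s.v t - ref.v t) + feedforward P ref t

/-- The three ways of fixing the rotation about the desired thrust direction: the first body
vector is given explicitly, or it is computed from the reference attitude, or the desired attitude
is the tilt taking `e₃` to the thrust direction, composed with a rotation by the angle `ψ`. -/
inductive HeadingRule where
  | explicit (b₁ : ℝ → E3)
  | reference
  | tilt (ψ : ℝ → ℝ)

/-- Third desired body vector. -/
noncomputable def bd3 (fd : E3) : E3 := ‖fd‖⁻¹ • fd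

/-- The matrix with columns `b₁`, `b₃ × b₁`, `b₃`. -/
noncomputable def frame (b₁ b₃ : E3) : Mat3 :=
  Matrix.of fun i j => (![b₁, cross b₃ b₁, b₃] j) i

/-- First desired body vector, obtained by projecting the first reference body vector. -/
noncomputable def projectedHeading (b₃ br₁ : E3) : E3 :=
  -(‖cross b₃ br₁‖⁻¹ • cross b₃ (cross b₃ br₁))

/-- Length of the horizontal part of a vector. -/
noncomputable def horizontalNorm (fd : E3) : ℝ := √(fd 0 ^ 2 + fd 1 ^ 2)

/-- `X_A = Exp([β n / 2]^)` with `β = atan2(√(f₁² + f₂²), f₃)` and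
`n = (f₁² + f₂²)^(-1/2) (-f₂, f₁, 0)`. -/
noncomputable def tiltAttitude (fd : E3) : Mat2 :=
  su2Exp ((Complex.arg ⟨fd 2, horizontalNorm fd⟩ / 2) •
    ((horizontalNorm fd)⁻¹ • !₂[-fd 1, fd 0, 0]))

/-- The desired rotation matrix at time `t`, from the desired force and the first reference body
vector at that time. -/
noncomputable def HeadingRule.rotation (h : HeadingRule) (t : ℝ) (fd br₁ : E3) : Mat3 :=
  match h with
  | .explicit b₁ => frame (b₁ t) (bd3 fd)
  | .reference => frame (projectedHeading (bd3 fd) br₁) (bd3 fd)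
  | .tilt ψ => rot (tiltAttitude fd * su2Exp ((ψ t / 2) • basisVec 2))

/-- No denominator in the construction vanishes, and an explicitly given first body vector is a
unit vector orthogonal to the third one. -/
def HeadingRule.Regular (h : HeadingRule) (t : ℝ) (fd br₁ : E3) : Prop :=
  fd ≠ 0 ∧
  match h with
  | .explicit b₁ => ‖b₁ t‖ = 1 ∧ inner ℝ (b₁ t) (bd3 fd) = 0
  | .reference => cross (bd3 fd) br₁ ≠ 0
  | .tilt _ => horizontalNorm fd ≠ 0

/-- A desired attitude on `SU(2)`, the desired rotation matrix, and the first and second time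
derivatives of the latter. -/
structure Desired where
  X : ℝ → SU2
  R : ℝ → Mat3
  R' : ℝ → Mat3
  R'' : ℝ → Mat3

/-- Desired attitude rate `ω_d = [R_dᵀ Ṙ_d]^∨`. -/
noncomputable def Desired.w (d : Desired) (t : ℝ) : E3 := so3Vee ((d.R t)ᵀ * d.R' t)

/-- Its time derivative, `[Ṙ_dᵀ Ṙ_d + R_dᵀ R̈_d]^∨`. -/
noncomputable def Desired.dw (d : Desired) (t : ℝ) : E3 :=
  so3Vee ((d.R' t)ᵀ * d.R' t + (d.R t)ᵀ * d.R'' t)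

/-- The desired attitude reference is well defined on `I`: its rotation matrix is formed from the
desired force by the rule `h`, is twice differentiable, and is lifted continuously to `SU(2)`. -/
structure IsDesired (P : Params) (G : Gains) (I : Set ℝ) (h : HeadingRule) (ref s : Motion)
    (d : Desired) : Prop where
  regular : ∀ t ∈ I,
    h.Regular t (desiredForce P G ref s t) (act (rot (ref.X t)) (basisVec 0))
  rotation : ∀ t ∈ I, d.R t =
    h.rotation t (desiredForce P G ref s t) (act (rot (ref.X t)) (basisVec 0))
  deriv₁ : ∀ t ∈ I, ∀ i j, HasDerivWithinAt (fun r => d.R r i j) (d.R' t i j) I t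
  deriv₂ : ∀ t ∈ I, ∀ i j, HasDerivWithinAt (fun r => d.R' r i j) (d.R'' t i j) I t
  lift : ∀ t ∈ I, rot (d.X t) = d.R t
  continuous_lift : ContinuousOn d.X I

/-! ### Errors and feedback -/

/-- The attitude error `X_e = X_d* X`. -/
noncomputable def attErr (d : Desired) (s : Motion) (t : ℝ) : Mat2 :=
  (d.X t : Mat2)ᴴ * (s.X t : Mat2)

/-- `e_X = [X_e - tr(X_e) I / 2]^∨ / 2`. -/
noncomputable def eX (d : Desired) (s : Motion) (t : ℝ) : E3 :=
  (1 / 2 : ℝ) • su2Vee (attErr d s t - ((attErr d s t).trace / 2) • (1 : Mat2))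

/-- `e_ω = ω - [X_e* [ω_d]^ X_e]^∨`. -/
noncomputable def eW (d : Desired) (s : Motion) (t : ℝ) : E3 :=
  s.w t - su2Vee ((attErr d s t)ᴴ * su2Hat (d.w t) * attErr d s t)

/-- The attitude tracking torque. -/
noncomputable def torqueLaw (P : Params) (G : Gains) (d : Desired) (s : Motion) (t : ℝ) : E3 :=
  -(G.kX • eX d s t) - G.kw • eW d s t - cross (act P.J (s.w t)) (s.w t)
    + act P.J (su2Vee (
      -(su2Hat ((1 / 2 : ℝ) • eW d s t) * (attErr d s t)ᴴ * su2Hat (d.w t) * attErr d s t)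
      + (attErr d s t)ᴴ * su2Hat (d.dw t) * attErr d s t
      + (attErr d s t)ᴴ * su2Hat (d.w t) * attErr d s t * su2Hat ((1 / 2 : ℝ) • eW d s t)))

/-- Closed loop on `I`: the reference `ref` and the motion `s` satisfy the UAV dynamics, the
desired attitude reference is well defined, the thrust is `f_d · R e₃`, and the torque is given by
the attitude controller tracking the desired attitude reference. -/
structure ClosedLoop (P : Params) (G : Gains) (I : Set ℝ) (h : HeadingRule) (ref s : Motion)
    (d : Desired) : Prop where
  reference : IsUAVMotion P I ref
  motion : IsUAVMotion P I s
  desired : IsDesired P G I h ref s d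
  thrust : ∀ t ∈ I, s.f t =
    inner ℝ (desiredForce P G ref s t) (act (rot (s.X t)) (basisVec 2))
  torque : ∀ t ∈ I, s.tau t = torqueLaw P G d s t

/-- Square of the Euclidean norm of `z_p = (‖e_p‖, ‖e_v‖)`. -/
noncomputable def zpSq (ref s : Motion) (t : ℝ) : ℝ :=
  ‖s.p t - ref.p t‖ ^ 2 + ‖s.v t - ref.v t‖ ^ 2

/-- Square of the Euclidean norm of `z_a = (‖e_X‖, ‖e_ω‖)`. -/
noncomputable def zaSq (d : Desired) (s : Motion) (t : ℝ) : ℝ :=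
  ‖eX d s t‖ ^ 2 + ‖eW d s t‖ ^ 2

/-- Euclidean norm of the error `(e_p, e_v, e_X, e_ω)` in `ℝ¹²`. -/
noncomputable def errNorm (ref s : Motion) (d : Desired) (t : ℝ) : ℝ :=
  √(zpSq ref s t + zaSq d s t)

/-! ### Gain matrices and the domain -/

/-- The matrix `W^{aa}`. -/
noncomputable def Waa (P : Params) (G : Gains) : Matrix (Fin 2) (Fin 2) ℝ :=
  !![G.ca * G.kX / maxEig P.J, -(G.ca * G.kw / (2 * minEig P.J));
     -(G.ca * G.kw / (2 * minEig P.J)), G.kw - G.ca / 4]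

/-- The matrix `M₁^{aa}`. -/
noncomputable def M1aa (P : Params) (G : Gains) : Matrix (Fin 2) (Fin 2) ℝ :=
  (1 / 2 : ℝ) • !![4 * G.kX, -G.ca; -G.ca, minEig P.J]

/-- The matrix `M₂^{aa}`. -/
noncomputable def M2aa (P : Params) (G : Gains) (φ : ℝ) : Matrix (Fin 2) (Fin 2) ℝ :=
  (1 / 2 : ℝ) • !![8 * G.kX / (2 - φ), G.ca; G.ca, maxEig P.J]

/-- The matrix `M₁^{pp}`. -/
noncomputable def M1pp (P : Params) (G : Gains) : Matrix (Fin 2) (Fin 2) ℝ :=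
  (1 / 2 : ℝ) • !![G.kp, -G.cp; -G.cp, P.m]

/-- The matrix `M₂^{pp}`. -/
noncomputable def M2pp (P : Params) (G : Gains) : Matrix (Fin 2) (Fin 2) ℝ :=
  (1 / 2 : ℝ) • !![G.kp, G.cp; G.cp, P.m]

/-- The constant `α = 2 √(2 φ)`. -/
noncomputable def alpha (φ : ℝ) : ℝ := 2 * √(2 * φ)

/-- The matrix `W^{pp}`. -/
noncomputable def Wpp (P : Params) (G : Gains) (φ : ℝ) : Matrix (Fin 2) (Fin 2) ℝ :=
  !![G.cp * G.kp / P.m * (1 - alpha φ), -(G.cp * G.kv / (2 * P.m) * (1 + alpha φ));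
     -(G.cp * G.kv / (2 * P.m) * (1 + alpha φ)), G.kv * (1 - alpha φ) - G.cp]

/-- The matrix `W^{pa}`. -/
noncomputable def Wpa (P : Params) (G : Gains) (Bf Bp : ℝ) : Matrix (Fin 2) (Fin 2) ℝ :=
  (4 : ℝ) • !![Bf * G.cp / P.m, 0; Bf + G.kp * Bp, 0]

/-- The constant `B_z = 4 λ_min(W^{aa}) λ_min(W^{pp}) - ‖W^{pa}‖²`. -/
noncomputable def Bz (P : Params) (G : Gains) (φ Bf Bp : ℝ) : ℝ :=
  4 * minEig (Waa P G) * minEig (Wpp P G φ) - opNorm (Wpa P G Bf Bp) ^ 2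

/-- The errors at the initial time `t₀` lie in the domain `D`. -/
structure InDomain (P : Params) (G : Gains) (φ Bp : ℝ) (ref s : Motion) (d : Desired) (t₀ : ℝ) :
    Prop where
  attitude : gam (d.X t₀) (s.X t₀) ≤ φ
  rate : ‖eW d s t₀‖ ^ 2 ≤ 2 / maxEig P.J * G.kX * (φ - gam (d.X t₀) (s.X t₀))
  total : maxEig (M2aa P G φ) * zaSq d s t₀ + maxEig (M2pp P G) * zpSq ref s t₀
    ≤ 1 / 2 * G.kp * Bp ^ 2

end SU2UAV

open SU2UAV

/-!
The closed loop is a cascade: the attitude error evolves on its own, whatever the position does, and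
it disturbs the position only through the factor `|e_X|`.

*Attitude.* `X_e` is a unit quaternion `(q₀, q)` with `e_X = q / 2` and `Γ = 1 - q₀`. The desired
attitude is only assumed to be a continuous lift of a differentiable curve of rotations, but such a
lift is differentiable with `Ẋ_d = X_d [ω_d / 2]^` (`hasMatDeriv_lift`). This gives
`Ẋ_e = X_e [e_ω / 2]^`, and the torque is chosen such that `J ė_ω = -k_X e_X - k_ω e_ω`. The energy
`k_X Γ + e_ω · J e_ω / 2` has derivative `-k_ω |e_ω|²`, so that `Γ ≤ φ` persists
(`ClosedLoop.gam_le`); with the cross term `c_a e_X · e_ω` it is a strict Lyapunov function because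
`W^{aa}` and `M₁^{aa}` are positive definite. Hence `(e_X, e_ω)` decays exponentially.

*Position.* All three heading rules make `R_d e₃` the direction of `f_d`
(`HeadingRule.act_rotation`). The force that acts is the projection of `f_d` on `R e₃`, and it
differs from `f_d` by at most `4 |e_X| |f_d|` (`norm_thrust_error_le`), where `|f_d|` is at most
`k_p |e_p| + k_v |e_v| + B_f`. So the Lyapunov function of `(e_p, e_v)` with cross term
`c_p e_p · e_v` satisfies `V̇ ≤ -w |z_p|² + K₁ |e_X| |z_p| + K₂ |e_X| |z_p|²`
(`pos_dissipation`).

*Cascade.* Since `|e_X|` is bounded by a fixed multiple of a decaying exponential, the term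
`K₂ |e_X| |z_p|²` is integrable relative to `V`. It is absorbed by multiplying `V` with a bounded
time-varying weight `exp (κ / a * exp (-a (t - t₀)))`, and `K₁ |e_X| |z_p|` is absorbed by Young's
inequality and a multiple of the attitude Lyapunov function. The sum of the two is a strict Lyapunov
function for the whole error (`exists_cascade_bound`). In this way no bound of `|e_p|` along the
solution is needed.
-/

namespace SU2UAV

open scoped Matrix

/-! ### Quadratic forms -/

theorem act_apply (A : Mat3) (x : E3) (i : Fin 3) :
    act A x i = A i 0 * x 0 + A i 1 * x 1 + A i 2 * x 2 := by
  simp [act, Matrix.mulVec, dotProduct, Fin.sum_univ_three]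

theorem inner_eq (x y : E3) : inner ℝ x y = x 0 * y 0 + x 1 * y 1 + x 2 * y 2 := by
  simp [PiLp.inner_apply, Fin.sum_univ_three]; ring

theorem norm_sq_eq (x : E3) : ‖x‖ ^ 2 = x 0 ^ 2 + x 1 ^ 2 + x 2 ^ 2 := by
  rw [← real_inner_self_eq_norm_sq, inner_eq]; ring

theorem act_sub (A : Mat3) (x y : E3) : act A (x - y) = act A x - act A y := by
  ext i; simp only [act_apply, PiLp.sub_apply]; ring

theorem act_smul (A : Mat3) (c : ℝ) (x : E3) : act A (c • x) = c • act A x := by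
  ext i; simp only [act_apply, PiLp.smul_apply, smul_eq_mul]; ring

theorem act_mul (A B : Mat3) (x : E3) : act (A * B) x = act A (act B x) := by
  ext i
  simp only [act_apply, Matrix.mul_apply, Fin.sum_univ_three]; ring

theorem act_one (x : E3) : act 1 x = x := by
  simp [act]

theorem inner_act_transpose (A : Mat3) (x y : E3) :
    inner ℝ (act A x) y = inner ℝ x (act Aᵀ y) := by
  simp only [inner_eq, act_apply, Matrix.transpose_apply]; ring

theorem inner_act_eq_dotProduct (A : Mat3) (x : E3) :
    inner ℝ x (act A x) = x.ofLp ⬝ᵥ A *ᵥ x.ofLp := by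
  simp [inner_eq, act, dotProduct, Fin.sum_univ_three]

theorem inner_act_le_maxEig {A : Mat3} (hA : A.IsHermitian) (x : E3) :
    inner ℝ x (act A x) ≤ maxEig A * ‖x‖ ^ 2 := by
  have hB : (algebraMap ℝ Mat3 (maxEig A) - A).IsHermitian := by
    refine Matrix.IsHermitian.sub ?_ hA
    rw [Matrix.algebraMap_eq_diagonal]
    exact Matrix.isHermitian_diagonal _
  have hpos : (algebraMap ℝ Mat3 (maxEig A) - A).PosSemidef := by
    rw [hB.posSemidef_iff_eigenvalues_nonneg]
    intro i
    have h1 := hB.eigenvalues_mem_spectrum_real i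
    rw [← spectrum.singleton_sub_eq] at h1
    obtain ⟨a, ha, b, hb, hab⟩ := h1
    rw [Set.mem_singleton_iff] at ha
    have : b ≤ maxEig A := le_csSup (Matrix.finite_real_spectrum).bddAbove hb
    simp only [Pi.zero_apply]
    rw [← hab, ha]
    simpa using this
  have h2 := hpos.dotProduct_mulVec_nonneg x.ofLp
  rw [inner_act_eq_dotProduct, norm_sq_eq]
  rw [Matrix.sub_mulVec, dotProduct_sub, Algebra.algebraMap_eq_smul_one, Matrix.smul_mulVec,
    Matrix.one_mulVec] at h2
  simp only [dotProduct_smul, star_trivial] at h2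
  have h3 : x.ofLp ⬝ᵥ x.ofLp = x 0 ^ 2 + x 1 ^ 2 + x 2 ^ 2 := by
    simp [dotProduct, Fin.sum_univ_three]; ring
  rw [h3] at h2
  simpa using h2

theorem minEig_le_inner_act {A : Mat3} (hA : A.IsHermitian) (x : E3) :
    minEig A * ‖x‖ ^ 2 ≤ inner ℝ x (act A x) := by
  have hB : (A - algebraMap ℝ Mat3 (minEig A)).IsHermitian := by
    refine Matrix.IsHermitian.sub hA ?_
    rw [Matrix.algebraMap_eq_diagonal]
    exact Matrix.isHermitian_diagonal _
  have hpos : (A - algebraMap ℝ Mat3 (minEig A)).PosSemidef := by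
    rw [hB.posSemidef_iff_eigenvalues_nonneg]
    intro i
    have h1 := hB.eigenvalues_mem_spectrum_real i
    rw [← spectrum.sub_singleton_eq] at h1
    obtain ⟨b, hb, a, ha, hab⟩ := h1
    rw [Set.mem_singleton_iff] at ha
    have : minEig A ≤ b := csInf_le (Matrix.finite_real_spectrum).bddBelow hb
    simp only [Pi.zero_apply]
    rw [← hab, ha]
    simpa using this
  have h2 := hpos.dotProduct_mulVec_nonneg x.ofLp
  rw [inner_act_eq_dotProduct, norm_sq_eq]
  rw [Matrix.sub_mulVec, dotProduct_sub, Algebra.algebraMap_eq_smul_one, Matrix.smul_mulVec,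
    Matrix.one_mulVec] at h2
  simp only [dotProduct_smul, star_trivial] at h2
  have h3 : x.ofLp ⬝ᵥ x.ofLp = x 0 ^ 2 + x 1 ^ 2 + x 2 ^ 2 := by
    simp [dotProduct, Fin.sum_univ_three]; ring
  rw [h3] at h2
  simpa using h2

theorem minEig_pos {A : Mat3} (hA : A.PosDef) : 0 < minEig A := by
  have h : minEig A ∈ spectrum ℝ A := by
    refine Set.Nonempty.csInf_mem ?_ Matrix.finite_real_spectrum
    exact ⟨_, hA.1.eigenvalues_mem_spectrum_real 0⟩
  rw [hA.1.spectrum_real_eq_range_eigenvalues] at h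
  obtain ⟨i, hi⟩ := h
  rw [← hi]
  exact hA.eigenvalues_pos i

theorem minEig_le_maxEig {A : Mat3} (hA : A.IsHermitian) : minEig A ≤ maxEig A := by
  have h := hA.eigenvalues_mem_spectrum_real 0
  exact (csInf_le Matrix.finite_real_spectrum.bddBelow h).trans
    (le_csSup Matrix.finite_real_spectrum.bddAbove h)

/-- The form of the inverse of `A` is bounded below by `1 / λ_max(A)`, in terms of `A a`. -/
theorem norm_act_sq_le {A : Mat3} (hA : A.PosDef) (a : E3) :
    ‖act A a‖ ^ 2 ≤ maxEig A * inner ℝ a (act A a) := by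
  have hmax : 0 < maxEig A := (minEig_pos hA).trans_le (minEig_le_maxEig hA.1)
  have hT : Aᵀ = A := by simpa [Matrix.conjTranspose_eq_transpose_of_trivial] using hA.1.eq
  set b := act A a with hb
  have key : ∀ x : E3, 0 ≤ inner ℝ x (act A x) := fun x =>
    (mul_nonneg (minEig_pos hA).le (sq_nonneg _)).trans (minEig_le_inner_act hA.1 x)
  -- the form of `A` at `λ_max a - A a` is nonnegative
  have h1 := key (maxEig A • a - b)
  have h2 := inner_act_le_maxEig hA.1 b
  have h3 : inner ℝ a (act A b) = ‖b‖ ^ 2 := by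
    rw [← real_inner_self_eq_norm_sq]
    nth_rewrite 2 [hb]
    rw [inner_act_transpose, hT]
  rw [act_sub, act_smul, inner_sub_left, inner_sub_right, inner_sub_right, inner_smul_left,
    inner_smul_left, inner_smul_right, inner_smul_right, h3, ← hb, real_inner_self_eq_norm_sq] at h1
  simp only [conj_trivial] at h1
  nlinarith

theorem minEig_mul_norm_le {A : Mat3} (hA : A.PosDef) (a : E3) :
    minEig A * ‖a‖ ≤ ‖act A a‖ := by
  rcases (norm_nonneg a).eq_or_lt with h | h
  · rw [← h]; simp
  · have h1 := minEig_le_inner_act hA.1 a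
    have h2 := real_inner_le_norm a (act A a)
    nlinarith

theorem act_surjective {A : Mat3} (hA : A.PosDef) (x : E3) : ∃ a, act A a = x := by
  refine ⟨act A⁻¹ x, ?_⟩
  rw [← act_mul, Matrix.mul_nonsing_inv _ (Ne.isUnit hA.det_pos.ne'), act_one]

theorem act_injective {A : Mat3} (hA : A.PosDef) {x y : E3} (h : act A x = act A y) : x = y := by
  have := congrArg (act A⁻¹) h
  rwa [← act_mul, ← act_mul, Matrix.nonsing_inv_mul _ (Ne.isUnit hA.det_pos.ne'), act_one,
    act_one] at this

/-- A positive definite binary form dominates a multiple of the squared norm. -/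
theorem exists_pos_le_form {a b c : ℝ} (h : (!![a, b; b, c] : Matrix (Fin 2) (Fin 2) ℝ).PosDef) :
    ∃ μ > 0, ∀ x y : ℝ, μ * (x ^ 2 + y ^ 2) ≤ a * x ^ 2 + 2 * b * x * y + c * y ^ 2 := by
  have ha : 0 < a := by simpa using h.diag_pos (i := 0)
  have hc : 0 < c := by simpa using h.diag_pos (i := 1)
  have hd : 0 < a * c - b * b := by simpa [Matrix.det_fin_two] using h.det_pos
  refine ⟨(a * c - b * b) / (a + c), by positivity, fun x y => ?_⟩
  rw [div_mul_eq_mul_div, div_le_iff₀ (by positivity)]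
  nlinarith [sq_nonneg (a * x + b * y), sq_nonneg (b * x + c * y)]

/-! ### Differential inequalities -/

theorem timeIco_convex (t₀ : ℝ) (T : EReal) : Convex ℝ (timeIco t₀ T) := by
  refine Set.OrdConnected.convex ⟨fun x hx y hy z hz => ⟨hx.1.trans hz.1, ?_⟩⟩
  exact lt_of_le_of_lt (EReal.coe_le_coe_iff.2 hz.2) hy.2

theorem timeIco_left_mem {t₀ : ℝ} {T : EReal} (h : (t₀ : EReal) < T) : t₀ ∈ timeIco t₀ T :=
  ⟨le_rfl, h⟩

theorem timeIco_uniqueDiffOn {t₀ : ℝ} {T : EReal} (h : (t₀ : EReal) < T) :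
    UniqueDiffOn ℝ (timeIco t₀ T) := by
  obtain ⟨s, hs, hsT⟩ := EReal.lt_iff_exists_real_btwn.1 h
  refine uniqueDiffOn_convex (timeIco_convex _ _) ⟨(t₀ + s) / 2, ?_⟩
  have hs' : t₀ < s := EReal.coe_lt_coe_iff.1 hs
  refine mem_interior.2 ⟨Set.Ioo t₀ s, fun x hx => ⟨hx.1.le, ?_⟩, isOpen_Ioo, ?_, ?_⟩
  · exact (EReal.coe_lt_coe_iff.2 hx.2).trans hsT
  · linarith
  · linarith

/-- A function with nonpositive derivative on `[t₀, T)` stays below its initial value. -/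
theorem le_initial {t₀ : ℝ} {T : EReal} {f f' : ℝ → ℝ}
    (hf : ∀ t ∈ timeIco t₀ T, HasDerivWithinAt f (f' t) (timeIco t₀ T) t)
    (hf' : ∀ t ∈ timeIco t₀ T, f' t ≤ 0) {t : ℝ} (ht : t ∈ timeIco t₀ T) : f t ≤ f t₀ := by
  have h : AntitoneOn f (timeIco t₀ T) := by
    refine antitoneOn_of_hasDerivWithinAt_nonpos (f' := f') (timeIco_convex _ _)
      (fun x hx => (hf x hx).continuousWithinAt)
      (fun x hx => (hf x (interior_subset hx)).mono interior_subset)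
      (fun x hx => hf' x (interior_subset hx))
  exact h ⟨le_rfl, lt_of_le_of_lt (EReal.coe_le_coe_iff.2 ht.1) ht.2⟩ ht ht.1

theorem hasDerivAt_exp_shift (c t₀ t : ℝ) :
    HasDerivAt (fun r => Real.exp (c * (r - t₀))) (c * Real.exp (c * (t - t₀))) t := by
  have := (((hasDerivAt_id t).sub_const t₀).const_mul c).exp
  simpa [mul_comm] using this

theorem le_exp_mul_initial {t₀ : ℝ} {T : EReal} {f f' : ℝ → ℝ} {c : ℝ}
    (hf : ∀ t ∈ timeIco t₀ T, HasDerivWithinAt f (f' t) (timeIco t₀ T) t)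
    (hf' : ∀ t ∈ timeIco t₀ T, f' t ≤ -c * f t) {t : ℝ} (ht : t ∈ timeIco t₀ T) :
    f t ≤ Real.exp (-c * (t - t₀)) * f t₀ := by
  have h := le_initial (f := fun r => Real.exp (c * (r - t₀)) * f r)
    (fun r hr => (hasDerivAt_exp_shift c t₀ r).hasDerivWithinAt.mul (hf r hr))
    (fun r hr => by
      have h1 := hf' r hr
      have h2 := Real.exp_pos (c * (r - t₀))
      nlinarith) ht
  simp only [sub_self, mul_zero, Real.exp_zero, one_mul] at h
  have h3 : Real.exp (-c * (t - t₀)) * Real.exp (c * (t - t₀)) = 1 := by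
    rw [← Real.exp_add]; simp
  calc f t = Real.exp (-c * (t - t₀)) * (Real.exp (c * (t - t₀)) * f t) := by
        rw [← mul_assoc, h3, one_mul]
    _ ≤ _ := mul_le_mul_of_nonneg_left h (Real.exp_pos _).le

/-- Pointwise estimate behind `exists_cascade_bound`: with a weight `e ∈ [1, E]` whose logarithmic
derivative is `-κ x`, the terms of order `ξ η²` are absorbed by the weight, and those of order
`ξ η` by Young's inequality and the multiple `N` of the Lyapunov function of `ξ`. -/
theorem cascade_pointwise {μ₂ wa ν₁ ν₂ wp K₁ K₂ κ₀ κ E N c e x ξ η Va Va' Vp Vp' : ℝ}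
    (hν₁ : 0 < ν₁) (hwp : 0 < wp) (hK₂ : 0 ≤ K₂) (hκ₀ : 0 ≤ κ₀) (hκ : κ = K₂ * κ₀ / ν₁)
    (hN : 0 ≤ N) (hNwa : N * wa = E * (K₁ ^ 2 / (2 * wp)) + 1)
    (hc : 0 ≤ c) (hc1 : c * ν₂ ≤ wp / 2) (hc2 : c * (N * μ₂) ≤ 1)
    (he1 : 1 ≤ e) (he2 : e ≤ E) (hx : 0 ≤ x) (hξ : ξ ≤ κ₀ * x)
    (hVa : Va ≤ μ₂ * ξ ^ 2) (hVp1 : ν₁ * η ^ 2 ≤ Vp) (hVp2 : Vp ≤ ν₂ * η ^ 2)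
    (hVa' : Va' ≤ -wa * ξ ^ 2) (hVp' : Vp' ≤ -wp * η ^ 2 + K₁ * ξ * η + K₂ * ξ * η ^ 2) :
    e * -(κ * x) * Vp + e * Vp' + N * Va' ≤ -c * (e * Vp + N * Va) := by
  have g5 : K₂ * ξ * η ^ 2 ≤ κ * x * Vp := by
    have hκ0 : 0 ≤ κ := by rw [hκ]; positivity
    calc K₂ * ξ * η ^ 2 ≤ K₂ * (κ₀ * x) * η ^ 2 := by gcongr
      _ = κ * x * (ν₁ * η ^ 2) := by rw [hκ]; field_simp
      _ ≤ _ := by gcongr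
  have g6 : K₁ * ξ * η ≤ wp / 2 * η ^ 2 + K₁ ^ 2 / (2 * wp) * ξ ^ 2 := by
    have h1 : wp / 2 * η ^ 2 + K₁ ^ 2 / (2 * wp) * ξ ^ 2 - K₁ * ξ * η
        = (wp * η - K₁ * ξ) ^ 2 / (2 * wp) := by field_simp; ring
    have h2 : 0 ≤ (wp * η - K₁ * ξ) ^ 2 / (2 * wp) := by positivity
    linarith
  have g7 : Vp' - κ * x * Vp ≤ -(wp / 2) * η ^ 2 + K₁ ^ 2 / (2 * wp) * ξ ^ 2 := by
    linarith
  have g8 : e * (Vp' - κ * x * Vp)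
      ≤ e * (-(wp / 2) * η ^ 2) + E * (K₁ ^ 2 / (2 * wp) * ξ ^ 2) := by
    calc e * (Vp' - κ * x * Vp)
        ≤ e * (-(wp / 2) * η ^ 2 + K₁ ^ 2 / (2 * wp) * ξ ^ 2) := by gcongr
      _ = e * (-(wp / 2) * η ^ 2) + e * (K₁ ^ 2 / (2 * wp) * ξ ^ 2) := by ring
      _ ≤ _ := by gcongr
  have g9 : N * Va' ≤ -(E * (K₁ ^ 2 / (2 * wp)) + 1) * ξ ^ 2 := by
    calc N * Va' ≤ N * (-wa * ξ ^ 2) := by gcongr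
      _ = -(N * wa) * ξ ^ 2 := by ring
      _ = _ := by rw [hNwa]
  have g10 : c * (e * Vp) ≤ e * (wp / 2 * η ^ 2) := by
    calc c * (e * Vp) ≤ c * (e * (ν₂ * η ^ 2)) := by gcongr
      _ = e * ((c * ν₂) * η ^ 2) := by ring
      _ ≤ _ := by gcongr
  have g11 : c * (N * Va) ≤ ξ ^ 2 := by
    calc c * (N * Va) ≤ c * (N * (μ₂ * ξ ^ 2)) := by gcongr
      _ = (c * (N * μ₂)) * ξ ^ 2 := by ring
      _ ≤ 1 * ξ ^ 2 := by gcongr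
      _ = _ := one_mul _
  linarith

/-- **Exponential stability of a cascade.** The driving error `ξ` decays exponentially because of
its Lyapunov function `Va`. It enters the derivative of the Lyapunov function `Vp` of the driven
error `η` linearly and as a factor of `η²`. The constants do not depend on the solution, and the
bound is linear in the initial errors. -/
theorem exists_cascade_bound {μ₁ μ₂ wa ν₁ ν₂ wp K₁ K₂ B : ℝ} (hμ₁ : 0 < μ₁) (hμ₂ : 0 < μ₂)
    (hwa : 0 < wa) (hν₁ : 0 < ν₁) (hν₂ : 0 < ν₂) (hwp : 0 < wp) (hK₂ : 0 ≤ K₂)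
    (hB : 0 ≤ B) :
    ∃ C > (0 : ℝ), ∃ γ > (0 : ℝ), ∀ (t₀ : ℝ) (T : EReal) (Va Va' Vp Vp' ξ η : ℝ → ℝ),
      (∀ t ∈ timeIco t₀ T, HasDerivWithinAt Va (Va' t) (timeIco t₀ T) t) →
      (∀ t ∈ timeIco t₀ T, HasDerivWithinAt Vp (Vp' t) (timeIco t₀ T) t) →
      (∀ t ∈ timeIco t₀ T, 0 ≤ ξ t) →
      (∀ t ∈ timeIco t₀ T, μ₁ * ξ t ^ 2 ≤ Va t ∧ Va t ≤ μ₂ * ξ t ^ 2) →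
      (∀ t ∈ timeIco t₀ T, ν₁ * η t ^ 2 ≤ Vp t ∧ Vp t ≤ ν₂ * η t ^ 2) →
      (∀ t ∈ timeIco t₀ T, Va' t ≤ -wa * ξ t ^ 2) →
      (∀ t ∈ timeIco t₀ T, Vp' t ≤ -wp * η t ^ 2 + K₁ * ξ t * η t + K₂ * ξ t * η t ^ 2) →
      ξ t₀ ≤ B →
      ∀ t ∈ timeIco t₀ T,
        √(η t ^ 2 + ξ t ^ 2) ≤ C * Real.exp (-γ * (t - t₀)) * √(η t₀ ^ 2 + ξ t₀ ^ 2) := by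
  -- `ξ t ≤ κ₀ exp (-a (t - t₀))`
  obtain ⟨a, ha⟩ : ∃ y : ℝ, y = wa / μ₂ / 2 := ⟨_, rfl⟩
  have ha0 : 0 < a := by rw [ha]; positivity
  obtain ⟨κ₀, hκ₀⟩ : ∃ y : ℝ, y = √(μ₂ / μ₁) * B := ⟨_, rfl⟩
  have hκ₀0 : 0 ≤ κ₀ := by rw [hκ₀]; positivity
  -- the weight `exp (κ / a * exp (-a (t - t₀)))` has values in `[1, E]`
  obtain ⟨κ, hκ⟩ : ∃ y : ℝ, y = K₂ * κ₀ / ν₁ := ⟨_, rfl⟩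
  have hκ0 : 0 ≤ κ := by rw [hκ]; positivity
  obtain ⟨E, hE⟩ : ∃ y : ℝ, y = Real.exp (κ / a) := ⟨_, rfl⟩
  have hE1 : 1 ≤ E := by rw [hE]; exact Real.one_le_exp (by positivity)
  -- the multiple of `Va` that pays for Young's inequality and leaves a term `-ξ²`
  obtain ⟨N, hN⟩ : ∃ y : ℝ, y = (E * (K₁ ^ 2 / (2 * wp)) + 1) / wa := ⟨_, rfl⟩
  have hN0 : 0 < N := by rw [hN]; positivity
  have hNwa : N * wa = E * (K₁ ^ 2 / (2 * wp)) + 1 := by rw [hN]; field_simp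
  -- decay rate of the combined Lyapunov function `weight * Vp + N * Va`
  obtain ⟨c, hc⟩ : ∃ y : ℝ, y = min (wp / (2 * ν₂)) (1 / (N * μ₂)) := ⟨_, rfl⟩
  have hc0 : 0 < c := hc ▸ lt_min (by positivity) (by positivity)
  have hc1 : c * ν₂ ≤ wp / 2 := by
    have : c ≤ wp / (2 * ν₂) := hc ▸ min_le_left _ _
    rw [le_div_iff₀ (by positivity)] at this
    linarith
  have hc2 : c * (N * μ₂) ≤ 1 := by
    have : c ≤ 1 / (N * μ₂) := hc ▸ min_le_right _ _
    rwa [le_div_iff₀ (by positivity)] at this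
  obtain ⟨l, hl⟩ : ∃ y : ℝ, y = min ν₁ (N * μ₁) := ⟨_, rfl⟩
  have hl0 : 0 < l := hl ▸ lt_min hν₁ (by positivity)
  obtain ⟨u, hu⟩ : ∃ y : ℝ, y = max (E * ν₂) (N * μ₂) := ⟨_, rfl⟩
  have hu0 : 0 < u := hu ▸ lt_max_of_lt_right (by positivity)
  refine ⟨√(u / l), by positivity, c / 2, by positivity, ?_⟩
  intro t₀ T Va Va' Vp Vp' ξ η hVa hVp hξ hVab hVpb hVa' hVp' hξB t ht
  have hT : (t₀ : EReal) < T := lt_of_le_of_lt (EReal.coe_le_coe_iff.2 ht.1) ht.2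
  have ht₀ := timeIco_left_mem hT
  have hξdecay : ∀ r ∈ timeIco t₀ T, ξ r ≤ κ₀ * Real.exp (-a * (r - t₀)) := by
    intro r hr
    have h1 := le_exp_mul_initial (c := 2 * a) hVa (fun s hs => by
      have h1 := hVa' s hs
      have h2 := (hVab s hs).2
      have h3 : 2 * a * μ₂ = wa := by rw [ha]; field_simp
      nlinarith) hr
    have h2 := (hVab r hr).1
    have h3 := (hVab t₀ ht₀).2
    have h4 : ξ t₀ ^ 2 ≤ B ^ 2 := pow_le_pow_left₀ (hξ _ ht₀) hξB 2
    have hexp : Real.exp (-(2 * a) * (r - t₀)) = Real.exp (-a * (r - t₀)) ^ 2 := by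
      rw [← Real.exp_nat_mul]; congr 1; push_cast; ring
    have h5 : μ₁ * ξ r ^ 2 ≤ Real.exp (-a * (r - t₀)) ^ 2 * (μ₂ * B ^ 2) := by
      calc μ₁ * ξ r ^ 2 ≤ _ := h2.trans h1
        _ ≤ _ := by rw [hexp]; gcongr; exact h3.trans (by gcongr)
    refine le_of_sq_le_sq ?_ (by positivity)
    have h6 : (κ₀ * Real.exp (-a * (r - t₀))) ^ 2
        = Real.exp (-a * (r - t₀)) ^ 2 * (μ₂ * B ^ 2) / μ₁ := by
      rw [hκ₀, mul_pow, mul_pow, Real.sq_sqrt (by positivity)]; ring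
    rw [h6, le_div_iff₀ hμ₁]
    linarith
  -- the time-varying weight that absorbs the terms `ξ η²`
  obtain ⟨h, hh⟩ : ∃ h : ℝ → ℝ, h = fun r => κ / a * Real.exp (-a * (r - t₀)) := ⟨_, rfl⟩
  have hhd : ∀ r, HasDerivAt h (-(κ * Real.exp (-a * (r - t₀)))) r := by
    intro r
    have := (hasDerivAt_exp_shift (-a) t₀ r).const_mul (κ / a)
    rw [hh]
    have h2 : κ / a * (-a * Real.exp (-a * (r - t₀))) = -(κ * Real.exp (-a * (r - t₀))) := by
      rw [← mul_assoc, mul_neg, div_mul_cancel₀ _ ha0.ne', neg_mul]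
    rwa [h2] at this
  have hE_ge : ∀ r, 1 ≤ Real.exp (h r) := fun r => Real.one_le_exp (by rw [hh]; positivity)
  have hE_le : ∀ r ∈ timeIco t₀ T, Real.exp (h r) ≤ E := by
    intro r hr
    rw [hE]
    refine Real.exp_le_exp.2 ?_
    have : Real.exp (-a * (r - t₀)) ≤ 1 := Real.exp_le_one_iff.2 (by nlinarith [hr.1])
    calc h r ≤ κ / a * 1 := by
          rw [hh]; exact mul_le_mul_of_nonneg_left this (by positivity)
      _ = κ / a := mul_one _
  have hVp0 : ∀ r ∈ timeIco t₀ T, 0 ≤ Vp r := fun r hr =>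
    (by positivity : 0 ≤ ν₁ * η r ^ 2).trans (hVpb r hr).1
  have hL := le_exp_mul_initial (c := c) (f := fun r => Real.exp (h r) * Vp r + N * Va r)
    (fun r hr => ((hhd r).exp.hasDerivWithinAt.mul (hVp r hr)).add ((hVa r hr).const_mul N))
    (fun r hr => cascade_pointwise hν₁ hwp hK₂ hκ₀0 hκ hN0.le hNwa hc0.le hc1 hc2 (hE_ge r)
      (hE_le r hr) (Real.exp_pos _).le (hξdecay r hr) (hVab r hr).2 (hVpb r hr).1 (hVpb r hr).2
      (hVa' r hr) (hVp' r hr)) ht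
  have hlow : l * (η t ^ 2 + ξ t ^ 2) ≤ Real.exp (h t) * Vp t + N * Va t := by
    have h1 : l * η t ^ 2 ≤ Real.exp (h t) * Vp t := by
      calc l * η t ^ 2 ≤ ν₁ * η t ^ 2 := by gcongr; rw [hl]; exact min_le_left _ _
        _ ≤ 1 * Vp t := by rw [one_mul]; exact (hVpb t ht).1
        _ ≤ _ := mul_le_mul_of_nonneg_right (hE_ge t) (hVp0 t ht)
    have h2 : l * ξ t ^ 2 ≤ N * Va t := by
      calc l * ξ t ^ 2 ≤ N * μ₁ * ξ t ^ 2 := by gcongr; rw [hl]; exact min_le_right _ _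
        _ = N * (μ₁ * ξ t ^ 2) := by ring
        _ ≤ _ := by gcongr; exact (hVab t ht).1
    linarith
  have hup : Real.exp (h t₀) * Vp t₀ + N * Va t₀ ≤ u * (η t₀ ^ 2 + ξ t₀ ^ 2) := by
    have h1 : Real.exp (h t₀) * Vp t₀ ≤ u * η t₀ ^ 2 := by
      calc Real.exp (h t₀) * Vp t₀ ≤ E * (ν₂ * η t₀ ^ 2) :=
            mul_le_mul (hE_le _ ht₀) (hVpb _ ht₀).2 (hVp0 _ ht₀) (by positivity)
        _ = E * ν₂ * η t₀ ^ 2 := by ring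
        _ ≤ _ := by gcongr; rw [hu]; exact le_max_left _ _
    have h2 : N * Va t₀ ≤ u * ξ t₀ ^ 2 := by
      calc N * Va t₀ ≤ N * (μ₂ * ξ t₀ ^ 2) := by gcongr; exact (hVab _ ht₀).2
        _ = N * μ₂ * ξ t₀ ^ 2 := by ring
        _ ≤ _ := by gcongr; rw [hu]; exact le_max_right _ _
    linarith
  have hfin : η t ^ 2 + ξ t ^ 2
      ≤ u / l * Real.exp (-c * (t - t₀)) * (η t₀ ^ 2 + ξ t₀ ^ 2) := by
    have h1 : l * (η t ^ 2 + ξ t ^ 2)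
        ≤ Real.exp (-c * (t - t₀)) * (u * (η t₀ ^ 2 + ξ t₀ ^ 2)) :=
      hlow.trans (hL.trans (by gcongr))
    have h2 : u / l * Real.exp (-c * (t - t₀)) * (η t₀ ^ 2 + ξ t₀ ^ 2)
        = Real.exp (-c * (t - t₀)) * (u * (η t₀ ^ 2 + ξ t₀ ^ 2)) / l := by ring
    rw [h2, le_div_iff₀ hl0]
    linarith
  have hexp : Real.exp (-c * (t - t₀)) = Real.exp (-(c / 2) * (t - t₀)) ^ 2 := by
    rw [← Real.exp_nat_mul]; congr 1; push_cast; ring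
  rw [hexp] at hfin
  calc √(η t ^ 2 + ξ t ^ 2) ≤ _ := Real.sqrt_le_sqrt hfin
    _ = _ := by
      rw [Real.sqrt_mul (by positivity), Real.sqrt_mul (by positivity),
        Real.sqrt_sq (Real.exp_pos _).le]

/-! ### Unit quaternions and rotations -/

theorem su2Hat_smul (c : ℝ) (a : E3) : su2Hat (c • a) = (c : ℂ) • su2Hat a := by
  ext i j; fin_cases i <;> fin_cases j <;> simp [su2Hat] <;> ring

theorem su2Hat_sub (a b : E3) : su2Hat (a - b) = su2Hat a - su2Hat b := by
  ext i j; fin_cases i <;> fin_cases j <;> simp [su2Hat] <;> ring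

theorem conjTranspose_su2Hat (a : E3) : (su2Hat a)ᴴ = -su2Hat a := by
  ext i j; fin_cases i <;> fin_cases j <;> simp [su2Hat] <;> ring

theorem trace_su2Hat (a : E3) : (su2Hat a).trace = 0 := by
  simp [su2Hat, Matrix.trace_fin_two]

theorem su2Vee_su2Hat (a : E3) : su2Vee (su2Hat a) = a := by
  ext i; fin_cases i <;> simp [su2Hat, su2Vee]

theorem su2Hat_su2Vee {K : Mat2} (h : Kᴴ = -K) (ht : K.trace = 0) : su2Hat (su2Vee K) = K := by
  have h00 := congrFun (congrFun h 0) 0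
  have h01 := congrFun (congrFun h 0) 1
  have h11 := congrFun (congrFun h 1) 1
  rw [Matrix.trace_fin_two] at ht
  simp only [Matrix.conjTranspose_apply, Matrix.neg_apply, RCLike.star_def, Complex.ext_iff,
    Complex.conj_re, Complex.conj_im, Complex.neg_re, Complex.neg_im, Complex.add_re,
    Complex.add_im, Complex.zero_re, Complex.zero_im] at h00 h01 h11 ht
  ext i j
  fin_cases i <;> fin_cases j <;> apply Complex.ext <;> simp [su2Hat, su2Vee] <;> linarith

/-- The quaternion with scalar part `c` and vector part `q`, as a complex `2 × 2` matrix. -/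
noncomputable def quat (c : ℝ) (q : E3) : Mat2 := (c : ℂ) • (1 : Mat2) + su2Hat q

theorem quat_eq (c : ℝ) (q : E3) : quat c q =
    !![(c : ℂ) + Complex.I * (q 2 : ℂ), -(q 1 : ℂ) + Complex.I * (q 0 : ℂ);
     (q 1 : ℂ) + Complex.I * (q 0 : ℂ), c - (Complex.I * (q 2 : ℂ))] := by
  ext i j; fin_cases i <;> fin_cases j <;> simp [quat, su2Hat]; ring

theorem su2Vee_quat (c : ℝ) (q : E3) : su2Vee (quat c q) = q := by
  ext i; fin_cases i <;> simp [quat_eq, su2Vee]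

theorem rot_quat (c : ℝ) (q : E3) : rot (quat c q) =
    !![c ^ 2 + q 0 ^ 2 - q 1 ^ 2 - q 2 ^ 2, 2 * (q 0 * q 1 - c * q 2), 2 * (q 0 * q 2 + c * q 1);
      2 * (q 0 * q 1 + c * q 2), c ^ 2 - q 0 ^ 2 + q 1 ^ 2 - q 2 ^ 2, 2 * (q 1 * q 2 - c * q 0);
      2 * (q 0 * q 2 - c * q 1), 2 * (q 1 * q 2 + c * q 0),
        c ^ 2 - q 0 ^ 2 - q 1 ^ 2 + q 2 ^ 2] := by
  ext i j
  fin_cases i <;> fin_cases j <;>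
    simp [rot, quat_eq, su2Vee, su2Hat, basisVec, Matrix.mul_apply] <;> ring

theorem conjTranspose_mul_self_SU2 (X : SU2) : (X : Mat2)ᴴ * (X : Mat2) = 1 :=
  Matrix.mem_unitaryGroup_iff'.1 (Matrix.mem_specialUnitaryGroup_iff.1 X.2).1

theorem mul_conjTranspose_self_SU2 (X : SU2) : (X : Mat2) * (X : Mat2)ᴴ = 1 :=
  Matrix.mem_unitaryGroup_iff.1 (Matrix.mem_specialUnitaryGroup_iff.1 X.2).1

/-- Scalar part of a quaternion matrix. -/
noncomputable def scal (X : Mat2) : ℝ := X.trace.re / 2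

theorem conjTranspose_eq_adjugate (X : SU2) : (X : Mat2)ᴴ = (X : Mat2).adjugate := by
  have hdet : (X : Mat2).det = 1 := (Matrix.mem_specialUnitaryGroup_iff.1 X.2).2
  calc (X : Mat2)ᴴ = (X : Mat2)ᴴ * ((X : Mat2) * (X : Mat2).adjugate) := by
        rw [Matrix.mul_adjugate, hdet, one_smul, Matrix.mul_one]
    _ = _ := by rw [← Matrix.mul_assoc, conjTranspose_mul_self_SU2, Matrix.one_mul]

/-- Elements of `SU(2)` are quaternions. -/
theorem SU2_eq_quat (X : SU2) : (X : Mat2) = quat (scal X) (su2Vee X) := by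
  have h := conjTranspose_eq_adjugate X
  have h00 := congrFun (congrFun h 0) 0
  have h01 := congrFun (congrFun h 0) 1
  simp only [Matrix.adjugate_fin_two, Matrix.conjTranspose_apply, RCLike.star_def,
    Complex.ext_iff, Complex.conj_re, Complex.conj_im] at h00 h01
  simp at h00 h01
  rw [quat_eq]
  ext i j
  fin_cases i <;> fin_cases j <;> apply Complex.ext <;>
    simp [scal, su2Vee, Matrix.trace_fin_two] <;> linarith

/-- Elements of `SU(2)` are quaternions of norm one. -/
theorem scal_sq_add_norm_sq (X : SU2) : scal X ^ 2 + ‖su2Vee X‖ ^ 2 = 1 := by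
  have hdet : (X : Mat2).det = 1 := (Matrix.mem_specialUnitaryGroup_iff.1 X.2).2
  rw [SU2_eq_quat X, quat_eq, Matrix.det_fin_two] at hdet
  have := congrArg Complex.re hdet
  simp at this
  rw [norm_sq_eq]
  linarith

theorem conj_su2Hat_skew (Y : Mat2) (a : E3) :
    (Yᴴ * su2Hat a * Y)ᴴ = -(Yᴴ * su2Hat a * Y) := by
  simp [Matrix.conjTranspose_mul, conjTranspose_su2Hat, Matrix.mul_assoc]

theorem su2Hat_su2Vee_conj {Y : Mat2} (hY : Y * Yᴴ = 1) (a : E3) :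
    su2Hat (su2Vee (Yᴴ * su2Hat a * Y)) = Yᴴ * su2Hat a * Y := by
  refine su2Hat_su2Vee (conj_su2Hat_skew Y a) ?_
  rw [Matrix.trace_mul_cycle, hY, Matrix.one_mul, trace_su2Hat]

theorem su2Vee_add (K L : Mat2) : su2Vee (K + L) = su2Vee K + su2Vee L := by
  ext i; fin_cases i <;> simp [su2Vee] <;> ring

theorem su2Vee_smul (c : ℝ) (K : Mat2) : su2Vee ((c : ℂ) • K) = c • su2Vee K := by
  ext i; fin_cases i <;> simp [su2Vee] <;> ring

theorem su2Hat_eq_sum (b : E3) : su2Hat b = ((b 0 : ℝ) : ℂ) • su2Hat (basisVec 0)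
    + ((b 1 : ℝ) : ℂ) • su2Hat (basisVec 1) + ((b 2 : ℝ) : ℂ) • su2Hat (basisVec 2) := by
  ext i j; fin_cases i <;> fin_cases j <;> simp [su2Hat, basisVec] <;> ring

theorem act_rot (X : Mat2) (b : E3) : act (rot X) b = su2Vee (X * su2Hat b * Xᴴ) := by
  rw [su2Hat_eq_sum b]
  simp only [Matrix.mul_add, Matrix.add_mul, Matrix.mul_smul, Matrix.smul_mul, su2Vee_add,
    su2Vee_smul]
  ext i
  simp only [act_apply, PiLp.add_apply, PiLp.smul_apply, smul_eq_mul, rot, Matrix.of_apply]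
  ring

theorem su2Hat_act_rot {X : Mat2} (hX : Xᴴ * X = 1) (b : E3) :
    su2Hat (act (rot X) b) = X * su2Hat b * Xᴴ := by
  rw [act_rot]
  have := su2Hat_su2Vee_conj (Y := Xᴴ) (by simpa using hX) b
  simpa using this

theorem eq_of_act_eq {A B : Mat3} (h : ∀ b, act A b = act B b) : A = B := by
  ext i j
  have := congrArg (fun v : E3 => v i) (h (basisVec j))
  fin_cases j <;> simpa [act_apply, basisVec] using this

theorem rot_mul (X : Mat2) {Y : Mat2} (hY : Yᴴ * Y = 1) : rot (X * Y) = rot X * rot Y := by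
  refine eq_of_act_eq fun b => ?_
  rw [act_mul, act_rot, act_rot X, su2Hat_act_rot hY, Matrix.conjTranspose_mul]
  simp only [Matrix.mul_assoc]

theorem rot_one : rot 1 = 1 := by
  refine eq_of_act_eq fun b => ?_
  rw [act_rot, act_one]; simp [su2Vee_su2Hat]

theorem conjTranspose_quat (c : ℝ) (q : E3) : (quat c q)ᴴ = quat c (-q) := by
  rw [quat_eq, quat_eq]
  ext i j; fin_cases i <;> fin_cases j <;> simp

theorem rot_conjTranspose (X : SU2) : rot (X : Mat2)ᴴ = (rot (X : Mat2))ᵀ := by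
  rw [SU2_eq_quat X, conjTranspose_quat, rot_quat, rot_quat]
  ext i j
  fin_cases i <;> fin_cases j <;> simp <;> ring

theorem rot_transpose_mul_self (X : SU2) : (rot (X : Mat2))ᵀ * rot (X : Mat2) = 1 := by
  rw [← rot_conjTranspose, ← rot_mul _ (conjTranspose_mul_self_SU2 X),
    conjTranspose_mul_self_SU2, rot_one]

theorem norm_act_rot (X : SU2) (b : E3) : ‖act (rot (X : Mat2)) b‖ = ‖b‖ := by
  rw [← sq_eq_sq₀ (norm_nonneg _) (norm_nonneg _), ← real_inner_self_eq_norm_sq,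
    inner_act_transpose, ← act_mul, rot_transpose_mul_self, act_one, real_inner_self_eq_norm_sq]

/-- `X₁* X₂` as an element of `SU(2)`. -/
noncomputable def relAtt (X₁ X₂ : SU2) : SU2 := star X₁ * X₂

theorem coe_relAtt (X₁ X₂ : SU2) : (relAtt X₁ X₂ : Mat2) = (X₁ : Mat2)ᴴ * (X₂ : Mat2) := rfl

theorem rot_relAtt (X₁ X₂ : SU2) :
    rot (relAtt X₁ X₂ : Mat2) = (rot (X₁ : Mat2))ᵀ * rot (X₂ : Mat2) := by
  rw [coe_relAtt, rot_mul _ (conjTranspose_mul_self_SU2 X₂), rot_conjTranspose]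

theorem gam_eq (X₁ X₂ : SU2) : gam X₁ X₂ = 1 - scal (relAtt X₁ X₂ : Mat2) := by
  simp [gam, scal, coe_relAtt, Matrix.trace_sub]; ring

/-! ### The exponential map and the desired thrust direction -/

/-- De Moivre's formula in a real algebra: the exponential of a multiple of an imaginary unit. -/
theorem exp_smul_of_mul_self_eq_neg_one {A : Mat2} (hA : A * A = -1) (θ : ℝ) :
    NormedSpace.exp (θ • A) = Real.cos θ • (1 : Mat2) + Real.sin θ • A := by
  let _ : NormedRing Mat2 := Matrix.linftyOpNormedRing
  let _ : NormedAlgebra ℝ Mat2 := Matrix.linftyOpNormedAlgebra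
  have hf : Continuous (Complex.lift ⟨A, hA⟩ : ℂ →ₐ[ℝ] Mat2) :=
    LinearMap.continuous_of_finiteDimensional (Complex.lift ⟨A, hA⟩ : ℂ →ₐ[ℝ] Mat2).toLinearMap
  have h := NormedSpace.map_exp (Complex.lift ⟨A, hA⟩ : ℂ →ₐ[ℝ] Mat2) hf (θ * Complex.I)
  rw [← Complex.exp_eq_exp_ℂ] at h
  have h1 : (Complex.lift ⟨A, hA⟩ : ℂ →ₐ[ℝ] Mat2) (θ * Complex.I) = θ • A := by
    simp [Complex.lift]
  have h2 : (Complex.lift ⟨A, hA⟩ : ℂ →ₐ[ℝ] Mat2) (Complex.exp (θ * Complex.I))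
      = Real.cos θ • (1 : Mat2) + Real.sin θ • A := by
    simp [Complex.lift, Complex.exp_ofReal_mul_I_re, Complex.exp_ofReal_mul_I_im,
      Algebra.algebraMap_eq_smul_one]
  rw [h1, h2] at h
  exact h.symm

theorem su2Hat_mul_self {n : E3} (hn : ‖n‖ = 1) : su2Hat n * su2Hat n = -1 := by
  have h : ((n 0 ^ 2 + n 1 ^ 2 + n 2 ^ 2 : ℝ) : ℂ) = 1 := by
    rw [← norm_sq_eq, hn]; norm_num
  push_cast at h
  ext i j
  fin_cases i <;> fin_cases j <;> simp [su2Hat, Matrix.mul_apply] <;> ring_nf <;>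
    (try simp only [Complex.I_sq]) <;> linear_combination -h

theorem su2Exp_smul {n : E3} (hn : ‖n‖ = 1) (θ : ℝ) :
    su2Exp (θ • n) = quat (Real.cos θ) (Real.sin θ • n) := by
  have h := exp_smul_of_mul_self_eq_neg_one (su2Hat_mul_self hn) θ
  rw [su2Exp, quat, su2Hat_smul, su2Hat_smul]
  exact h

theorem norm_basisVec (i : Fin 3) : ‖basisVec i‖ = 1 := by
  simp [basisVec]

theorem horizontalNorm_sq (fd : E3) : horizontalNorm fd ^ 2 = fd 0 ^ 2 + fd 1 ^ 2 :=
  Real.sq_sqrt (by positivity)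

theorem act_rot_tiltAttitude {fd : E3} (h : horizontalNorm fd ≠ 0) :
    act (rot (tiltAttitude fd)) (basisVec 2) = ‖fd‖⁻¹ • fd := by
  have hsq := horizontalNorm_sq fd
  set ρ := horizontalNorm fd with hρ
  set z : ℂ := ⟨fd 2, ρ⟩ with hz
  have hz0 : z ≠ 0 := fun h0 => h (by simpa [hz] using congrArg Complex.im h0)
  have hnz : ‖z‖ = ‖fd‖ := by
    rw [← sq_eq_sq₀ (norm_nonneg _) (norm_nonneg _), norm_sq_eq, ← Complex.normSq_eq_norm_sq,
      Complex.normSq_apply]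
    simp only [hz]
    nlinarith
  have hn : ‖(ρ⁻¹ • !₂[-fd 1, fd 0, 0] : E3)‖ = 1 := by
    rw [← sq_eq_sq₀ (norm_nonneg _) zero_le_one, norm_sq_eq]
    simp
    field_simp
    rw [hsq]; ring
  have hcos : Real.cos z.arg = fd 2 / ‖fd‖ := by rw [Complex.cos_arg hz0, hnz]
  have hsin : Real.sin z.arg = ρ / ‖fd‖ := by rw [Complex.sin_arg, hnz]
  have hfd : ‖fd‖ ≠ 0 := by rw [← hnz]; simpa using hz0
  have hc2 : Real.cos (z.arg / 2) ^ 2 - Real.sin (z.arg / 2) ^ 2 = fd 2 / ‖fd‖ := by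
    rw [← hcos, ← Real.cos_two_mul']; congr 1; ring
  have hs2 : 2 * Real.sin (z.arg / 2) * Real.cos (z.arg / 2) = ρ / ‖fd‖ := by
    rw [← hsin, ← Real.sin_two_mul]; congr 1; ring
  rw [tiltAttitude, su2Exp_smul hn, rot_quat]
  generalize Real.cos (z.arg / 2) = c at *
  generalize Real.sin (z.arg / 2) = s at *
  ext i
  fin_cases i
  · simp [act_apply, basisVec]
    rw [show 2 * (c * (s * (ρ⁻¹ * fd 0))) = (2 * s * c) * (ρ⁻¹ * fd 0) by ring, hs2]
    field_simp
  · simp [act_apply, basisVec]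
    rw [show 2 * (c * (s * (ρ⁻¹ * fd 1))) = (2 * s * c) * (ρ⁻¹ * fd 1) by ring, hs2]
    field_simp
  · simp [act_apply, basisVec]
    have e : (s * (ρ⁻¹ * fd 1)) ^ 2 + (s * (ρ⁻¹ * fd 0)) ^ 2 = s ^ 2 := by
      field_simp; rw [hsq]; ring
    have e2 : ‖fd‖⁻¹ * fd 2 = fd 2 / ‖fd‖ := inv_mul_eq_div _ _
    linarith

/-- A rotation about the third axis, applied first, does not change the image of that axis. -/
theorem act_rot_mul_su2Exp_axis (Y : Mat2) (a : ℝ) :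
    act (rot (Y * su2Exp (a • basisVec 2))) (basisVec 2) = act (rot Y) (basisVec 2) := by
  have hU : ∀ c s : ℝ, c ^ 2 + s ^ 2 = 1 →
      quat c (s • basisVec 2) * su2Hat (basisVec 2) * (quat c (s • basisVec 2))ᴴ
        = su2Hat (basisVec 2) := by
    intro c s hcs
    have hcs' : ((c : ℂ) ^ 2 + (s : ℂ) ^ 2) = 1 := by exact_mod_cast hcs
    rw [conjTranspose_quat, quat_eq, quat_eq]
    ext i j
    fin_cases i <;> fin_cases j <;> simp [su2Hat, basisVec, Matrix.mul_apply]
    · linear_combination Complex.I * hcs' - Complex.I * s ^ 2 * Complex.I_sq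
    · linear_combination Complex.I * hcs' - Complex.I * s ^ 2 * Complex.I_sq
  rw [act_rot, act_rot, su2Exp_smul (norm_basisVec 2), Matrix.conjTranspose_mul]
  congr 1
  have := hU (Real.cos a) (Real.sin a) (Real.cos_sq_add_sin_sq a)
  calc _ = Y * (quat (Real.cos a) (Real.sin a • basisVec 2) * su2Hat (basisVec 2)
        * (quat (Real.cos a) (Real.sin a • basisVec 2))ᴴ) * Yᴴ := by
        simp only [Matrix.mul_assoc]
    _ = _ := by rw [this]

theorem act_frame_basisVec_two (b₁ b₃ : E3) : act (frame b₁ b₃) (basisVec 2) = b₃ := by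
  ext i; simp [act_apply, frame, basisVec]

/-- Under each heading rule the desired attitude takes `e₃` to the direction of the desired
force. -/
theorem HeadingRule.act_rotation (h : HeadingRule) {t : ℝ} {fd br₁ : E3}
    (hr : h.Regular t fd br₁) : act (h.rotation t fd br₁) (basisVec 2) = ‖fd‖⁻¹ • fd := by
  cases h with
  | explicit b₁ => exact act_frame_basisVec_two _ _
  | reference => exact act_frame_basisVec_two _ _
  | tilt ψ => exact (act_rot_mul_su2Exp_axis _ _).trans (act_rot_tiltAttitude hr.2)

/-- Projecting the desired force on the actual thrust direction `R e₃` changes it by at most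
`|f_d| sin θ`, where `θ` is the angle between the desired and the actual thrust direction;
and `sin θ ≤ 2 |q|` for the vector part `q` of the attitude error. -/
theorem norm_thrust_error_le (Xd X : SU2) {fd : E3}
    (h : act (rot (Xd : Mat2)) (basisVec 2) = ‖fd‖⁻¹ • fd) :
    ‖inner ℝ fd (act (rot (X : Mat2)) (basisVec 2)) • act (rot (X : Mat2)) (basisVec 2) - fd‖
      ≤ 2 * ‖su2Vee (relAtt Xd X : Mat2)‖ * ‖fd‖ := by
  rcases eq_or_ne fd 0 with rfl | hfd
  · simp
  have hfd' : ‖fd‖ ≠ 0 := norm_ne_zero_iff.2 hfd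
  set r := act (rot (X : Mat2)) (basisVec 2) with hr
  have hr1 : inner ℝ r r = (1 : ℝ) := by
    rw [real_inner_self_eq_norm_sq, hr, norm_act_rot, norm_basisVec]; norm_num
  have hfd2 : fd = ‖fd‖ • act (rot (Xd : Mat2)) (basisVec 2) := by
    rw [h, smul_smul, mul_inv_cancel₀ hfd', one_smul]
  have hq := scal_sq_add_norm_sq (relAtt Xd X)
  rw [norm_sq_eq] at hq
  have hin : inner ℝ fd r = ‖fd‖ * (1 - 2 * (su2Vee (relAtt Xd X : Mat2) 0 ^ 2
      + su2Vee (relAtt Xd X : Mat2) 1 ^ 2)) := by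
    nth_rewrite 1 [hfd2]
    rw [inner_smul_left, inner_act_transpose, hr, ← act_mul, ← rot_relAtt,
      SU2_eq_quat (relAtt Xd X), rot_quat, su2Vee_quat]
    simp [inner_eq, act_apply, basisVec]
    left
    linarith
  refine le_of_sq_le_sq ?_ (by positivity)
  rw [← real_inner_self_eq_norm_sq, inner_sub_left, inner_sub_right, inner_sub_right,
    inner_smul_left, inner_smul_left, inner_smul_right, inner_smul_right, hr1,
    real_inner_comm fd r, real_inner_self_eq_norm_sq, mul_pow, mul_pow, norm_sq_eq (su2Vee _)]
  simp only [conj_trivial]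
  rw [hin]
  generalize su2Vee (relAtt Xd X : Mat2) 0 = x at *
  generalize su2Vee (relAtt Xd X : Mat2) 1 = y at *
  generalize su2Vee (relAtt Xd X : Mat2) 2 = z at *
  have e : 0 ≤ ‖fd‖ ^ 2 * ((x ^ 2 + y ^ 2) ^ 2 + z ^ 2) := by positivity
  nlinarith

/-! ### Entrywise derivatives -/

/-- The matrix function `A` has derivative `A'` within `I` at `t`, entry by entry. -/
def HasMatDeriv {m n 𝔸 : Type*} [NormedRing 𝔸] [NormedAlgebra ℝ 𝔸] (A : ℝ → Matrix m n 𝔸)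
    (A' : Matrix m n 𝔸) (I : Set ℝ) (t : ℝ) : Prop :=
  ∀ i j, HasDerivWithinAt (fun r => A r i j) (A' i j) I t

section HasMatDeriv

variable {l m n 𝔸 : Type*} [Fintype m] [NormedRing 𝔸] [NormedAlgebra ℝ 𝔸] {I : Set ℝ} {t : ℝ}

theorem HasMatDeriv.mul {A : ℝ → Matrix l m 𝔸} {B : ℝ → Matrix m n 𝔸} {A' : Matrix l m 𝔸}
    {B' : Matrix m n 𝔸} (hA : HasMatDeriv A A' I t) (hB : HasMatDeriv B B' I t) :
    HasMatDeriv (fun r => A r * B r) (A' * B t + A t * B') I t := by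
  intro i j
  simp only [Matrix.mul_apply, Matrix.add_apply, ← Finset.sum_add_distrib]
  exact HasDerivWithinAt.fun_sum fun k _ => (hA i k).mul (hB k j)

theorem hasMatDeriv_const (A : Matrix l n 𝔸) : HasMatDeriv (fun _ => A) 0 I t :=
  fun _ _ => hasDerivWithinAt_const _ _ _

theorem HasMatDeriv.const_mul (A : Matrix l m 𝔸) {B : ℝ → Matrix m n 𝔸} {B' : Matrix m n 𝔸}
    (hB : HasMatDeriv B B' I t) : HasMatDeriv (fun r => A * B r) (A * B') I t := by
  simpa using (hasMatDeriv_const A).mul hB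

theorem HasMatDeriv.transpose {A : ℝ → Matrix l n 𝔸} {A' : Matrix l n 𝔸}
    (hA : HasMatDeriv A A' I t) : HasMatDeriv (fun r => (A r)ᵀ) A'ᵀ I t :=
  fun i j => hA j i

end HasMatDeriv

theorem HasMatDeriv.conjTranspose {l n : Type*} {A : ℝ → Matrix l n ℂ} {A' : Matrix l n ℂ}
    {I : Set ℝ} {t : ℝ} (hA : HasMatDeriv A A' I t) : HasMatDeriv (fun r => (A r)ᴴ) A'ᴴ I t :=
  fun i j => (hA j i).star

theorem hasDerivWithinAt_re {f : ℝ → ℂ} {f' : ℂ} {I : Set ℝ} {t : ℝ}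
    (h : HasDerivWithinAt f f' I t) : HasDerivWithinAt (fun r => (f r).re) f'.re I t :=
  Complex.reCLM.hasFDerivAt.comp_hasDerivWithinAt t h

theorem hasDerivWithinAt_im {f : ℝ → ℂ} {f' : ℂ} {I : Set ℝ} {t : ℝ}
    (h : HasDerivWithinAt f f' I t) : HasDerivWithinAt (fun r => (f r).im) f'.im I t :=
  Complex.imCLM.hasFDerivAt.comp_hasDerivWithinAt t h

theorem hasDerivWithinAt_ofReal {f : ℝ → ℝ} {f' : ℝ} {I : Set ℝ} {t : ℝ}
    (h : HasDerivWithinAt f f' I t) : HasDerivWithinAt (fun r => (f r : ℂ)) (f' : ℂ) I t :=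
  Complex.ofRealCLM.hasFDerivAt.comp_hasDerivWithinAt t h

theorem hasDerivWithinAt_E3 {f : ℝ → E3} {f' : E3} {I : Set ℝ} {t : ℝ} :
    HasDerivWithinAt f f' I t ↔ ∀ i, HasDerivWithinAt (fun r => f r i) (f' i) I t := by
  rw [hasDerivWithinAt_iff_hasFDerivWithinAt, hasFDerivWithinAt_euclidean]
  refine forall_congr' fun i => ?_
  rw [hasDerivWithinAt_iff_hasFDerivWithinAt]
  have : (PiLp.proj 2 (fun _ : Fin 3 => ℝ) i).comp (ContinuousLinearMap.toSpanSingleton ℝ f')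
      = ContinuousLinearMap.toSpanSingleton ℝ (f' i) := by
    ext; simp
  rw [this]

theorem HasMatDeriv.su2Vee {K : ℝ → Mat2} {K' : Mat2} {I : Set ℝ} {t : ℝ}
    (h : HasMatDeriv K K' I t) :
    HasDerivWithinAt (fun r => SU2UAV.su2Vee (K r)) (SU2UAV.su2Vee K') I t := by
  rw [hasDerivWithinAt_E3]
  intro i
  fin_cases i
  · exact (hasDerivWithinAt_im ((h 0 1).add (h 1 0))).div_const 2
  · exact (hasDerivWithinAt_re ((h 1 0).sub (h 0 1))).div_const 2
  · exact (hasDerivWithinAt_im ((h 0 0).sub (h 1 1))).div_const 2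

theorem HasMatDeriv.scal {K : ℝ → Mat2} {K' : Mat2} {I : Set ℝ} {t : ℝ}
    (h : HasMatDeriv K K' I t) :
    HasDerivWithinAt (fun r => SU2UAV.scal (K r)) (SU2UAV.scal K') I t := by
  simp only [SU2UAV.scal, Matrix.trace_fin_two]
  exact (hasDerivWithinAt_re ((h 0 0).add (h 1 1))).div_const 2

theorem HasMatDeriv.so3Vee {K : ℝ → Mat3} {K' : Mat3} {I : Set ℝ} {t : ℝ}
    (h : HasMatDeriv K K' I t) :
    HasDerivWithinAt (fun r => SU2UAV.so3Vee (K r)) (SU2UAV.so3Vee K') I t := by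
  rw [hasDerivWithinAt_E3]
  intro i
  fin_cases i
  · exact h 2 1
  · exact h 0 2
  · exact h 1 0

theorem hasMatDeriv_quat {c : ℝ → ℝ} {q : ℝ → E3} {c' : ℝ} {q' : E3} {I : Set ℝ} {t : ℝ}
    (hc : HasDerivWithinAt c c' I t) (hq : HasDerivWithinAt q q' I t) :
    HasMatDeriv (fun r => quat (c r) (q r)) (quat c' q') I t := by
  have hc := hasDerivWithinAt_ofReal hc
  have hq := fun i => hasDerivWithinAt_ofReal (hasDerivWithinAt_E3.1 hq i)
  intro i j
  simp only [quat_eq]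
  fin_cases i <;> fin_cases j
  · exact hc.add ((hq 2).const_mul _)
  · exact (hq 1).neg.add ((hq 0).const_mul _)
  · exact (hq 1).add ((hq 0).const_mul _)
  · exact hc.sub ((hq 2).const_mul _)

theorem quat_zero_left (q : E3) : quat 0 q = su2Hat q := by simp [quat]

theorem hasMatDeriv_su2Hat {q : ℝ → E3} {q' : E3} {I : Set ℝ} {t : ℝ}
    (hq : HasDerivWithinAt q q' I t) :
    HasMatDeriv (fun r => su2Hat (q r)) (su2Hat q') I t := by
  simpa only [quat_zero_left] using hasMatDeriv_quat (hasDerivWithinAt_const t I (0 : ℝ)) hq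

/-! ### Kinematics of a continuous lift -/

/-- `Rᵀ R'` is skew-symmetric for a curve of orthogonal matrices. -/
theorem transpose_mul_deriv_skew {I : Set ℝ} {t : ℝ} (hI : UniqueDiffWithinAt ℝ I t)
    (ht : t ∈ I) {R : ℝ → Mat3} {R' : Mat3} (hR : HasMatDeriv R R' I t)
    (ho : ∀ r ∈ I, (R r)ᵀ * R r = 1) : ((R t)ᵀ * R')ᵀ = -((R t)ᵀ * R') := by
  have h := hR.transpose.mul hR
  have h0 : R'ᵀ * R t + (R t)ᵀ * R' = 0 := by
    ext i j
    refine hI.eq_deriv _ (h i j) ?_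
    refine (hasDerivWithinAt_const t I ((1 : Mat3) i j)).congr (fun r hr => ?_) ?_
    · exact congrFun (congrFun (ho r hr) i) j
    · exact congrFun (congrFun (ho t ht) i) j
  rw [Matrix.transpose_mul, Matrix.transpose_transpose]
  exact eq_neg_of_add_eq_zero_left h0

/-- A continuous lift to `SU(2)` of a differentiable curve of rotations is differentiable, and
satisfies the kinematic equation with the angular velocity of the curve. Relative to its value at
`t`, the scalar part of the lift is near `1`, so it is the positive root given by the trace of the
rotation, and the vector part is given by the skew-symmetric part of the rotation. -/
theorem hasMatDeriv_lift {I : Set ℝ} {t : ℝ} (hI : UniqueDiffWithinAt ℝ I t) (ht : t ∈ I)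
    {X : ℝ → SU2} (hX : ContinuousOn X I) {R : ℝ → Mat3} {R' : Mat3}
    (hR : HasMatDeriv R R' I t) (hl : ∀ r ∈ I, rot (X r) = R r) :
    HasMatDeriv (fun r => (X r : Mat2))
      ((X t : Mat2) * su2Hat ((1 / 2 : ℝ) • so3Vee ((R t)ᵀ * R'))) I t := by
  have hskew := transpose_mul_deriv_skew hI ht hR
    (fun r hr => by rw [← hl r hr]; exact rot_transpose_mul_self _)
  have hM : HasMatDeriv (fun r => (R t)ᵀ * R r) ((R t)ᵀ * R') I t := hR.const_mul _
  have hrot : ∀ r ∈ I, rot (relAtt (X t) (X r) : Mat2) = (R t)ᵀ * R r := fun r hr => by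
    rw [rot_relAtt, hl t ht, hl r hr]
  obtain ⟨M, hMdef⟩ : ∃ M : ℝ → Mat3, M = fun r => (R t)ᵀ * R r := ⟨_, rfl⟩
  obtain ⟨M', hM'def⟩ : ∃ M' : Mat3, M' = (R t)ᵀ * R' := ⟨_, rfl⟩
  rw [← hM'def] at hskew hM ⊢
  rw [← hMdef] at hM
  replace hrot : ∀ r ∈ I, rot (relAtt (X t) (X r) : Mat2) = M r := fun r hr => by
    rw [hrot r hr, hMdef]
  obtain ⟨c, hc⟩ : ∃ c : ℝ → ℝ, c = fun r => scal (relAtt (X t) (X r) : Mat2) := ⟨_, rfl⟩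
  obtain ⟨q, hq⟩ : ∃ q : ℝ → E3, q = fun r => su2Vee (relAtt (X t) (X r) : Mat2) := ⟨_, rfl⟩
  have hZ : ∀ r, (relAtt (X t) (X r) : Mat2) = quat (c r) (q r) := fun r => by
    rw [hc, hq]; exact SU2_eq_quat _
  have hunit : ∀ r, c r ^ 2 + (q r 0 ^ 2 + q r 1 ^ 2 + q r 2 ^ 2) = 1 := fun r => by
    rw [← norm_sq_eq, hc, hq]; exact scal_sq_add_norm_sq _
  have hMr : ∀ r ∈ I, M r = rot (quat (c r) (q r)) := fun r hr => by rw [← hrot r hr, hZ]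
  have htrace : ∀ r ∈ I, (1 + (M r 0 0 + M r 1 1 + M r 2 2)) / 4 = c r ^ 2 := by
    intro r hr
    have := hunit r
    rw [hMr r hr, rot_quat]
    simp
    linarith
  have hXt : relAtt (X t) (X t) = 1 := by
    ext1; rw [coe_relAtt, conjTranspose_mul_self_SU2]; rfl
  have hct : c t = 1 := by
    rw [hc]; simp [hXt, scal]
  -- the scalar part is positive near `t`
  have hccont : ContinuousWithinAt c I t := by
    have hcoe : ContinuousWithinAt (fun r => (X r : Mat2)) I t :=
      continuous_subtype_val.continuousAt.comp_continuousWithinAt (hX t ht)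
    have h1 : Continuous fun K : Mat2 => ((X t : Mat2)ᴴ * K).trace.re / 2 := by
      refine Continuous.div_const (Complex.continuous_re.comp ?_) 2
      exact (continuous_const.matrix_mul continuous_id).matrix_trace
    rw [hc]
    exact h1.continuousAt.comp_continuousWithinAt hcoe
  have hcpos : ∀ᶠ r in nhdsWithin t I, 0 < c r :=
    hccont.eventually (lt_mem_nhds (by rw [hct]; exact one_pos))
  have hmem : ∀ᶠ r in nhdsWithin t I, r ∈ I := eventually_mem_nhdsWithin
  have hs : ∀ i j, M' j i = -M' i j := fun i j => congrFun (congrFun hskew i) j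
  have h00 := hs 0 0
  have h11 := hs 1 1
  have h22 := hs 2 2
  -- derivative of the scalar part
  have hcd : HasDerivWithinAt c 0 I t := by
    have h1 : HasDerivWithinAt (fun r => (1 + (M r 0 0 + M r 1 1 + M r 2 2)) / 4)
        ((M' 0 0 + M' 1 1 + M' 2 2) / 4) I t :=
      ((((hM 0 0).add (hM 1 1)).add (hM 2 2)).const_add 1).div_const 4
    have h2 : (M' 0 0 + M' 1 1 + M' 2 2) / 4 = 0 := by linarith
    rw [h2] at h1
    have h3 := h1.sqrt (by rw [htrace t ht, hct]; norm_num)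
    rw [zero_div] at h3
    refine h3.congr_of_eventuallyEq ?_ ?_
    · filter_upwards [hcpos, hmem] with r hr hrI
      rw [htrace r hrI, Real.sqrt_sq hr.le]
    · rw [htrace t ht, hct]; norm_num
  -- derivative of the vector part
  have hqi : ∀ (k i j : Fin 3), (∀ r ∈ I, M r i j - M r j i = 4 * c r * q r k) → i ≠ j →
      HasDerivWithinAt (fun r => q r k) (1 / 2 * M' i j) I t := by
    intro k i j hk hij
    have h1 := ((hM i j).sub (hM j i)).div (hcd.const_mul 4) (by rw [hct]; norm_num)
    have h2 : ((M' i j - M' j i) * (4 * c t) - (M t i j - M t j i) * (4 * 0)) / (4 * c t) ^ 2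
        = 1 / 2 * M' i j := by
      rw [hct, hs i j]; ring
    refine (h1.congr_deriv h2).congr_of_eventuallyEq ?_ ?_
    · filter_upwards [hcpos, hmem] with r hr hrI
      simp only [Pi.sub_apply, Pi.div_apply]
      rw [hk r hrI]
      field_simp
    · simp only [Pi.sub_apply, Pi.div_apply]
      rw [hk t ht, hct]
      field_simp
  have hqd : HasDerivWithinAt q ((1 / 2 : ℝ) • so3Vee M') I t := by
    rw [hasDerivWithinAt_E3]
    intro k
    fin_cases k
    · exact hqi 0 2 1 (fun r hr => by rw [hMr r hr, rot_quat]; simp; ring) (by decide)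
    · exact hqi 1 0 2 (fun r hr => by rw [hMr r hr, rot_quat]; simp; ring) (by decide)
    · exact hqi 2 1 0 (fun r hr => by rw [hMr r hr, rot_quat]; simp; ring) (by decide)
  have hfin := (hasMatDeriv_quat hcd hqd).const_mul (X t : Mat2)
  rw [quat_zero_left] at hfin
  have hXr : ∀ r, (X r : Mat2) = (X t : Mat2) * quat (c r) (q r) := fun r => by
    rw [← hZ, coe_relAtt, ← Matrix.mul_assoc, mul_conjTranspose_self_SU2, Matrix.one_mul]
  intro i j
  exact (hfin i j).congr (fun r _ => congrFun (congrFun (hXr r) i) j)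
    (congrFun (congrFun (hXr t) i) j)

/-! ### Attitude error dynamics -/

theorem cross_apply (a b : E3) : cross a b =
    !₂[a 1 * b 2 - a 2 * b 1, a 2 * b 0 - a 0 * b 2, a 0 * b 1 - a 1 * b 0] := by
  ext i; fin_cases i <;> simp [cross, act_apply, crossMat] <;> ring

theorem inner_cross_self_right (a b : E3) : inner ℝ (cross a b) b = 0 := by
  simp [inner_eq, cross_apply]; ring

theorem su2Vee_quat_mul_su2Hat (c : ℝ) (q w : E3) :
    su2Vee (quat c q * su2Hat w) = c • w + cross q w := by
  ext i
  fin_cases i <;> simp [su2Vee, quat_eq, su2Hat, Matrix.mul_apply, cross_apply] <;> ring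

theorem scal_quat_mul_su2Hat (c : ℝ) (q w : E3) : scal (quat c q * su2Hat w) = -inner ℝ q w := by
  simp [scal, quat_eq, su2Hat, Matrix.trace_fin_two, inner_eq]; ring

theorem attErr_eq_quat (d : Desired) (s : Motion) (t : ℝ) :
    attErr d s t = quat (scal (attErr d s t)) (su2Vee (attErr d s t)) :=
  SU2_eq_quat (relAtt (d.X t) (s.X t))

theorem eX_eq (d : Desired) (s : Motion) (t : ℝ) :
    eX d s t = (1 / 2 : ℝ) • su2Vee (attErr d s t) := by
  ext i; fin_cases i <;> simp [eX, su2Vee]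

section ErrorDynamics

variable {P : Params} {G : Gains} {t₀ : ℝ} {T : EReal} {h : HeadingRule} {ref s : Motion}
  {d : Desired} {t : ℝ}

theorem ClosedLoop.hasMatDeriv_desired (hcl : ClosedLoop P G (timeIco t₀ T) h ref s d)
    (ht : t ∈ timeIco t₀ T) :
    HasMatDeriv (fun r => (d.X r : Mat2)) ((d.X t : Mat2) * su2Hat ((1 / 2 : ℝ) • d.w t))
      (timeIco t₀ T) t :=
  hasMatDeriv_lift (timeIco_uniqueDiffOn (lt_of_le_of_lt (EReal.coe_le_coe_iff.2 ht.1) ht.2) t ht)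
    ht hcl.desired.continuous_lift (hcl.desired.deriv₁ t ht) hcl.desired.lift

/-- `Ẋ_e = X_e [e_ω / 2]^`. -/
theorem ClosedLoop.hasMatDeriv_attErr (hcl : ClosedLoop P G (timeIco t₀ T) h ref s d)
    (ht : t ∈ timeIco t₀ T) :
    HasMatDeriv (attErr d s) (attErr d s t * su2Hat ((1 / 2 : ℝ) • eW d s t))
      (timeIco t₀ T) t := by
  have h1 := (hcl.hasMatDeriv_desired ht).conjTranspose.mul
    (show HasMatDeriv (fun r => (s.X r : Mat2)) _ _ t from hcl.motion.att t ht)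
  have hE : attErr d s t * (attErr d s t)ᴴ = 1 := mul_conjTranspose_self_SU2 (relAtt _ _)
  have h2 : ((d.X t : Mat2) * su2Hat ((1 / 2 : ℝ) • d.w t))ᴴ * (s.X t : Mat2)
      + (d.X t : Mat2)ᴴ * ((s.X t : Mat2) * su2Hat ((1 / 2 : ℝ) • s.w t))
      = attErr d s t * su2Hat ((1 / 2 : ℝ) • eW d s t) := by
    rw [eW, su2Hat_smul _ (s.w t - _), su2Hat_sub, su2Hat_su2Vee_conj hE, smul_sub,
      Matrix.mul_sub, ← su2Hat_smul, Matrix.mul_smul, ← Matrix.mul_assoc (attErr d s t),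
      ← Matrix.mul_assoc (attErr d s t), hE, Matrix.one_mul, Matrix.conjTranspose_mul,
      conjTranspose_su2Hat, su2Hat_smul _ (d.w t)]
    simp only [attErr, Matrix.neg_mul, Matrix.smul_mul, Matrix.mul_assoc]
    abel
  rw [h2] at h1
  exact h1

theorem ClosedLoop.hasDerivWithinAt_eX (hcl : ClosedLoop P G (timeIco t₀ T) h ref s d)
    (ht : t ∈ timeIco t₀ T) :
    HasDerivWithinAt (eX d s)
      ((scal (attErr d s t) / 4) • eW d s t + (1 / 2 : ℝ) • cross (eX d s t) (eW d s t))
      (timeIco t₀ T) t := by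
  have h1 := (hcl.hasMatDeriv_attErr ht).su2Vee.const_smul (1 / 2 : ℝ)
  have h2 : (1 / 2 : ℝ) • su2Vee (attErr d s t * su2Hat ((1 / 2 : ℝ) • eW d s t))
      = (scal (attErr d s t) / 4) • eW d s t + (1 / 2 : ℝ) • cross (eX d s t) (eW d s t) := by
    rw [eX_eq]
    nth_rewrite 1 [attErr_eq_quat]
    rw [su2Vee_quat_mul_su2Hat]
    ext i
    fin_cases i <;> simp [cross_apply] <;> ring
  rw [h2] at h1
  refine h1.congr (fun r _ => eX_eq d s r) (eX_eq d s t)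

/-- `Γ̇ = e_X · e_ω`. -/
theorem ClosedLoop.hasDerivWithinAt_gam (hcl : ClosedLoop P G (timeIco t₀ T) h ref s d)
    (ht : t ∈ timeIco t₀ T) :
    HasDerivWithinAt (fun r => gam (d.X r) (s.X r)) (inner ℝ (eX d s t) (eW d s t))
      (timeIco t₀ T) t := by
  have h1 := (hcl.hasMatDeriv_attErr ht).scal.const_sub 1
  have h2 : -scal (attErr d s t * su2Hat ((1 / 2 : ℝ) • eW d s t))
      = inner ℝ (eX d s t) (eW d s t) := by
    rw [eX_eq]
    nth_rewrite 1 [attErr_eq_quat]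
    rw [scal_quat_mul_su2Hat, inner_smul_left, inner_smul_right]
    simp
  rw [h2] at h1
  exact h1.congr (fun r _ => gam_eq _ _) (gam_eq _ _)

theorem IsDesired.hasDerivWithinAt_w {I : Set ℝ} (hd : IsDesired P G I h ref s d) (ht : t ∈ I) :
    HasDerivWithinAt d.w (d.dw t) I t := by
  have h1 := (HasMatDeriv.transpose (A := d.R) (hd.deriv₁ t ht)).mul
    (show HasMatDeriv d.R' _ _ t from hd.deriv₂ t ht)
  exact h1.so3Vee

/-- The closed-loop angular velocity error satisfies `J ė_ω = -k_X e_X - k_ω e_ω`. -/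
theorem ClosedLoop.exists_hasDerivWithinAt_eW (hcl : ClosedLoop P G (timeIco t₀ T) h ref s d)
    (ht : t ∈ timeIco t₀ T) :
    ∃ u : E3, HasDerivWithinAt (eW d s) u (timeIco t₀ T) t ∧
      act P.J u = -(G.kX • eX d s t) - G.kw • eW d s t := by
  have hE := hcl.hasMatDeriv_attErr ht
  have h1 := (hcl.motion.rate t ht).sub ((hE.conjTranspose.mul
    (hasMatDeriv_su2Hat (hcl.desired.hasDerivWithinAt_w ht))).mul hE).su2Vee
  refine ⟨_, h1, ?_⟩
  rw [act_sub, hcl.motion.torque t ht, hcl.torque t ht, torqueLaw]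
  have h2 : -(su2Hat ((1 / 2 : ℝ) • eW d s t) * (attErr d s t)ᴴ * su2Hat (d.w t) * attErr d s t)
      + (attErr d s t)ᴴ * su2Hat (d.dw t) * attErr d s t
      + (attErr d s t)ᴴ * su2Hat (d.w t) * attErr d s t * su2Hat ((1 / 2 : ℝ) • eW d s t)
      = ((attErr d s t * su2Hat ((1 / 2 : ℝ) • eW d s t))ᴴ * su2Hat (d.w t)
        + (attErr d s t)ᴴ * su2Hat (d.dw t)) * attErr d s t
        + (attErr d s t)ᴴ * su2Hat (d.w t)
          * (attErr d s t * su2Hat ((1 / 2 : ℝ) • eW d s t)) := by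
    rw [Matrix.conjTranspose_mul, conjTranspose_su2Hat, Matrix.add_mul]
    simp only [Matrix.neg_mul, Matrix.mul_assoc]
  rw [h2]
  abel

end ErrorDynamics

/-! ### Attitude Lyapunov functions -/

theorem hasDerivWithinAt_act (A : Mat3) {f : ℝ → E3} {f' : E3} {I : Set ℝ} {t : ℝ}
    (h : HasDerivWithinAt f f' I t) :
    HasDerivWithinAt (fun r => SU2UAV.act A (f r)) (SU2UAV.act A f') I t := by
  rw [hasDerivWithinAt_E3] at h ⊢
  intro i
  simp only [act_apply]
  exact (((h 0).const_mul _).add ((h 1).const_mul _)).add ((h 2).const_mul _)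

theorem hasDerivWithinAt_inner_act {A : Mat3} (hA : A.IsHermitian) {f : ℝ → E3} {f' : E3}
    {I : Set ℝ} {t : ℝ} (h : HasDerivWithinAt f f' I t) :
    HasDerivWithinAt (fun r => inner ℝ (f r) (SU2UAV.act A (f r)))
      (2 * inner ℝ (f t) (SU2UAV.act A f')) I t := by
  have hT : Aᵀ = A := by simpa [Matrix.conjTranspose_eq_transpose_of_trivial] using hA.eq
  have h1 := h.inner ℝ (hasDerivWithinAt_act A h)
  refine h1.congr_deriv ?_
  rw [real_inner_comm _ f', inner_act_transpose, hT, two_mul]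

/-- The component along `x` of the solution `u` of `J u = -k_X x - k_ω y`. -/
theorem inner_solution_le {J : Mat3} (hJ : J.PosDef) {kX kw : ℝ} (hkX : 0 ≤ kX) (hkw : 0 ≤ kw)
    {x y u : E3} (hu : act J u = -(kX • x) - kw • y) :
    inner ℝ x u ≤ -(kX / maxEig J * ‖x‖ ^ 2) + kw / minEig J * (‖x‖ * ‖y‖) := by
  obtain ⟨a, rfl⟩ := act_surjective hJ x
  obtain ⟨b, rfl⟩ := act_surjective hJ y
  have hmin := minEig_pos hJ
  have hmax : 0 < maxEig J := hmin.trans_le (minEig_le_maxEig hJ.1)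
  have hu' : u = -(kX • a) - kw • b := by
    refine act_injective hJ ?_
    rw [hu, act_sub, ← neg_smul, ← neg_smul, act_smul, act_smul]
  have h1 : ‖act J a‖ ^ 2 / maxEig J ≤ inner ℝ (act J a) a := by
    rw [div_le_iff₀ hmax, real_inner_comm, mul_comm]
    exact norm_act_sq_le hJ a
  have h2 : -inner ℝ (act J a) b ≤ ‖act J a‖ * (‖act J b‖ / minEig J) := by
    have h3 : ‖b‖ ≤ ‖act J b‖ / minEig J := by
      rw [le_div_iff₀ hmin, mul_comm]; exact minEig_mul_norm_le hJ b
    calc -inner ℝ (act J a) b ≤ |inner ℝ (act J a) b| := neg_le_abs _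
      _ ≤ ‖act J a‖ * ‖b‖ := abs_real_inner_le_norm _ _
      _ ≤ _ := by gcongr
  calc inner ℝ (act J a) u = kX * -inner ℝ (act J a) a + kw * -inner ℝ (act J a) b := by
        rw [hu', inner_sub_right, inner_neg_right, inner_smul_right, inner_smul_right]; ring
    _ ≤ kX * -(‖act J a‖ ^ 2 / maxEig J) + kw * (‖act J a‖ * (‖act J b‖ / minEig J)) := by
        gcongr
    _ = _ := by ring

theorem gam_mul_two_sub (d : Desired) (s : Motion) (t : ℝ) :
    gam (d.X t) (s.X t) * (2 - gam (d.X t) (s.X t)) = 4 * ‖eX d s t‖ ^ 2 := by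
  have h : scal (attErr d s t) ^ 2 + ‖su2Vee (attErr d s t)‖ ^ 2 = 1 :=
    scal_sq_add_norm_sq (relAtt (d.X t) (s.X t))
  have hg : gam (d.X t) (s.X t) = 1 - scal (attErr d s t) := gam_eq _ _
  rw [eX_eq, norm_smul, hg, mul_pow]
  norm_num
  linarith

theorem abs_scal_le_one (X : SU2) : |scal X| ≤ 1 := by
  have := scal_sq_add_norm_sq X
  rw [← sq_le_one_iff_abs_le_one]
  nlinarith [sq_nonneg ‖su2Vee X‖]

theorem gam_nonneg (X₁ X₂ : SU2) : 0 ≤ gam X₁ X₂ := by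
  rw [gam_eq]; linarith [(abs_le.1 (abs_scal_le_one (relAtt X₁ X₂))).2]

/-- The attitude energy `k_X Γ + e_ω · J e_ω / 2`. -/
noncomputable def attEnergy (P : Params) (G : Gains) (d : Desired) (s : Motion) (t : ℝ) : ℝ :=
  G.kX * gam (d.X t) (s.X t) + 1 / 2 * inner ℝ (eW d s t) (act P.J (eW d s t))

/-- The attitude Lyapunov function: the energy with a cross term `c_a e_X · e_ω`. -/
noncomputable def attLyap (P : Params) (G : Gains) (d : Desired) (s : Motion) (t : ℝ) : ℝ :=
  attEnergy P G d s t + G.ca * inner ℝ (eX d s t) (eW d s t)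

section Attitude

variable {P : Params} {G : Gains} {t₀ : ℝ} {T : EReal} {h : HeadingRule} {ref s : Motion}
  {d : Desired} {t : ℝ}

theorem ClosedLoop.hasDerivWithinAt_attEnergy (hJ : P.J.PosDef)
    (hcl : ClosedLoop P G (timeIco t₀ T) h ref s d) (ht : t ∈ timeIco t₀ T) :
    HasDerivWithinAt (attEnergy P G d s) (-(G.kw * ‖eW d s t‖ ^ 2)) (timeIco t₀ T) t := by
  obtain ⟨u, hu, hJu⟩ := hcl.exists_hasDerivWithinAt_eW ht
  have h1 := ((hcl.hasDerivWithinAt_gam ht).const_mul G.kX).add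
    ((hasDerivWithinAt_inner_act hJ.1 hu).const_mul (1 / 2))
  refine h1.congr_deriv ?_
  rw [hJu, inner_sub_right, inner_neg_right, inner_smul_right, inner_smul_right,
    real_inner_self_eq_norm_sq, real_inner_comm (eW d s t) (eX d s t)]
  ring

/-- Since the attitude energy does not increase, the attitude error stays in the sublevel set
`Γ ≤ φ`. -/
theorem ClosedLoop.gam_le (hJ : P.J.PosDef) (hkX : 0 < G.kX) (hkw : 0 < G.kw)
    (hcl : ClosedLoop P G (timeIco t₀ T) h ref s d) {φ Bp : ℝ}
    (hD : InDomain P G φ Bp ref s d t₀) (ht : t ∈ timeIco t₀ T) :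
    gam (d.X t) (s.X t) ≤ φ := by
  have hmax : 0 < maxEig P.J := (minEig_pos hJ).trans_le (minEig_le_maxEig hJ.1)
  have h1 := le_initial (fun r hr => hcl.hasDerivWithinAt_attEnergy hJ hr)
    (fun r _ => by have : 0 ≤ G.kw * ‖eW d s r‖ ^ 2 := by positivity
                   linarith) ht
  have h2 := inner_act_le_maxEig hJ.1 (eW d s t₀)
  have h3 := (mul_nonneg (minEig_pos hJ).le (sq_nonneg _)).trans
    (minEig_le_inner_act hJ.1 (eW d s t))
  have h4 : maxEig P.J * ‖eW d s t₀‖ ^ 2 ≤ 2 * (G.kX * (φ - gam (d.X t₀) (s.X t₀))) := by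
    calc maxEig P.J * ‖eW d s t₀‖ ^ 2
        ≤ maxEig P.J * (2 / maxEig P.J * G.kX * (φ - gam (d.X t₀) (s.X t₀))) := by
          gcongr; exact hD.rate
      _ = _ := by field_simp
  unfold attEnergy at h1
  refine le_of_mul_le_mul_left (a := G.kX) ?_ hkX
  linarith

theorem ClosedLoop.exists_hasDerivWithinAt_attLyap (hJ : P.J.PosDef) (hkX : 0 ≤ G.kX)
    (hkw : 0 ≤ G.kw) (hca : 0 ≤ G.ca)
    (hcl : ClosedLoop P G (timeIco t₀ T) h ref s d) (ht : t ∈ timeIco t₀ T) :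
    ∃ V' : ℝ, HasDerivWithinAt (attLyap P G d s) V' (timeIco t₀ T) t ∧
      V' ≤ -(G.ca * G.kX / maxEig P.J * ‖eX d s t‖ ^ 2
        + 2 * -(G.ca * G.kw / (2 * minEig P.J)) * ‖eX d s t‖ * ‖eW d s t‖
        + (G.kw - G.ca / 4) * ‖eW d s t‖ ^ 2) := by
  obtain ⟨u, hu, hJu⟩ := hcl.exists_hasDerivWithinAt_eW ht
  refine ⟨_, (hcl.hasDerivWithinAt_attEnergy hJ ht).add
    (((hcl.hasDerivWithinAt_eX ht).inner ℝ hu).const_mul G.ca), ?_⟩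
  have h1 := inner_solution_le hJ hkX hkw hJu
  have hs : scal (attErr d s t) ≤ 1 := (abs_le.1 (abs_scal_le_one (relAtt _ _))).2
  have h2 : inner ℝ ((scal (attErr d s t) / 4) • eW d s t
      + (1 / 2 : ℝ) • cross (eX d s t) (eW d s t)) (eW d s t) ≤ 1 / 4 * ‖eW d s t‖ ^ 2 := by
    rw [inner_add_left, inner_smul_left, inner_smul_left, inner_cross_self_right,
      real_inner_self_eq_norm_sq]
    simp only [conj_trivial, mul_zero, add_zero]
    gcongr
  have h3 := mul_le_mul_of_nonneg_left (add_le_add h1 h2) hca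
  refine (add_le_add_right h3 _).trans (le_of_eq ?_)
  have hmin := (minEig_pos hJ).ne'
  field_simp
  ring

theorem le_attLyap (hJ : P.J.PosDef) (hkX : 0 ≤ G.kX) (hca : 0 ≤ G.ca) (d : Desired) (s : Motion)
    (t : ℝ) :
    2 * G.kX * ‖eX d s t‖ ^ 2 + 2 * -(G.ca / 2) * ‖eX d s t‖ * ‖eW d s t‖
      + minEig P.J / 2 * ‖eW d s t‖ ^ 2 ≤ attLyap P G d s t := by
  have h1 : 2 * ‖eX d s t‖ ^ 2 ≤ gam (d.X t) (s.X t) := by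
    nlinarith [gam_mul_two_sub d s t, sq_nonneg (gam (d.X t) (s.X t))]
  have h2 := minEig_le_inner_act hJ.1 (eW d s t)
  have h3 := (abs_le.1 (abs_real_inner_le_norm (eX d s t) (eW d s t))).1
  have h4 := mul_le_mul_of_nonneg_left h1 hkX
  have h5 := mul_le_mul_of_nonneg_left h3 hca
  unfold attLyap attEnergy
  nlinarith

theorem attLyap_le (hJ : P.J.PosDef) (hkX : 0 ≤ G.kX) (hca : 0 ≤ G.ca) {φ : ℝ}
    (hφ : φ < 2) (hg : gam (d.X t) (s.X t) ≤ φ) :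
    attLyap P G d s t
      ≤ (4 * G.kX / (2 - φ) + G.ca + maxEig P.J) * (‖eX d s t‖ ^ 2 + ‖eW d s t‖ ^ 2) := by
  have hmax : 0 < maxEig P.J := (minEig_pos hJ).trans_le (minEig_le_maxEig hJ.1)
  have hφ' : 0 < 2 - φ := by linarith
  have h1 : gam (d.X t) (s.X t) ≤ 4 * ‖eX d s t‖ ^ 2 / (2 - φ) := by
    rw [le_div_iff₀ hφ', ← gam_mul_two_sub]
    have := gam_nonneg (d.X t) (s.X t)
    gcongr
  have h2 := inner_act_le_maxEig hJ.1 (eW d s t)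
  have h3 : inner ℝ (eX d s t) (eW d s t) ≤ ‖eX d s t‖ ^ 2 + ‖eW d s t‖ ^ 2 := by
    nlinarith [real_inner_le_norm (eX d s t) (eW d s t), sq_nonneg (‖eX d s t‖ - ‖eW d s t‖),
      sq_nonneg ‖eX d s t‖, sq_nonneg ‖eW d s t‖]
  have h4 := mul_le_mul_of_nonneg_left h1 hkX
  have h5 := mul_le_mul_of_nonneg_left h3 hca
  have e1 : G.kX * (4 * ‖eX d s t‖ ^ 2 / (2 - φ)) = 4 * G.kX / (2 - φ) * ‖eX d s t‖ ^ 2 := by ring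
  have e2 : 0 ≤ 4 * G.kX / (2 - φ) * ‖eW d s t‖ ^ 2 := by positivity
  have e3 : 0 ≤ maxEig P.J * ‖eX d s t‖ ^ 2 := by positivity
  have e4 : 0 ≤ maxEig P.J * ‖eW d s t‖ ^ 2 := by positivity
  unfold attLyap attEnergy
  linarith

end Attitude

/-! ### Position Lyapunov function -/

/-- The position Lyapunov function, with a cross term `c_p e_p · e_v`. -/
noncomputable def posLyap (P : Params) (G : Gains) (ref s : Motion) (t : ℝ) : ℝ :=
  1 / 2 * G.kp * ‖s.p t - ref.p t‖ ^ 2 + 1 / 2 * P.m * ‖s.v t - ref.v t‖ ^ 2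
    + G.cp * inner ℝ (s.p t - ref.p t) (s.v t - ref.v t)

/-- Dissipation estimate for `m ė_v = -k_p e_p - k_v e_v + Δ`, where the disturbance `Δ` is at
most `4 x` times a bound of the desired force. All contributions of `Δ` are kept as terms with a
factor `x`, so for `α ≥ 0` the form `W^{pp}`, which has a share `α` of them built in, bounds the
dissipation of the undisturbed system from below. -/
theorem pos_dissipation {m kp kv cp α wp B x : ℝ} (hm : 0 < m) (hkp : 0 ≤ kp) (hkv : 0 ≤ kv)
    (hcp : 0 ≤ cp) (hα : 0 ≤ α) (hx : 0 ≤ x)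
    (hW : ∀ a b : ℝ, wp * (a ^ 2 + b ^ 2) ≤ cp * kp / m * (1 - α) * a ^ 2
      + 2 * -(cp * kv / (2 * m) * (1 + α)) * a * b + (kv * (1 - α) - cp) * b ^ 2)
    {p v w Δ : E3} (hw : m • w = Δ - kp • p - kv • v)
    (hΔ : ‖Δ‖ ≤ 4 * x * (kp * ‖p‖ + kv * ‖v‖ + B)) {η : ℝ} (hη0 : 0 ≤ η)
    (hη : η ^ 2 = ‖p‖ ^ 2 + ‖v‖ ^ 2) :
    kp * inner ℝ p v + m * inner ℝ v w + cp * (inner ℝ p w + ‖v‖ ^ 2)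
      ≤ -wp * η ^ 2 + 4 * B * (1 + cp / m) * x * η
        + 4 * (kp + kv) * (1 + cp / m) * x * η ^ 2 := by
  have hpη : ‖p‖ ≤ η := le_of_sq_le_sq (by nlinarith [sq_nonneg ‖v‖]) hη0
  have hvη : ‖v‖ ≤ η := le_of_sq_le_sq (by nlinarith [sq_nonneg ‖p‖]) hη0
  have e1 : m * inner ℝ v w = inner ℝ v Δ - kp * inner ℝ p v - kv * ‖v‖ ^ 2 := by
    rw [← inner_smul_right, hw, inner_sub_right, inner_sub_right, inner_smul_right,
      inner_smul_right, real_inner_self_eq_norm_sq, real_inner_comm v p]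
  have e2 : inner ℝ p w = (inner ℝ p Δ - kp * ‖p‖ ^ 2 - kv * inner ℝ p v) / m := by
    rw [eq_div_iff hm.ne', mul_comm, ← inner_smul_right, hw, inner_sub_right, inner_sub_right,
      inner_smul_right, inner_smul_right, real_inner_self_eq_norm_sq]
  have d1 : inner ℝ v Δ + cp / m * inner ℝ p Δ
      ≤ 4 * B * (1 + cp / m) * x * η + 4 * (kp + kv) * (1 + cp / m) * x * η ^ 2 := by
    calc inner ℝ v Δ + cp / m * inner ℝ p Δ
        ≤ ‖v‖ * ‖Δ‖ + cp / m * (‖p‖ * ‖Δ‖) := by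
          gcongr
          · exact real_inner_le_norm _ _
          · exact real_inner_le_norm _ _
      _ ≤ η * ‖Δ‖ + cp / m * (η * ‖Δ‖) := by gcongr
      _ = (1 + cp / m) * η * ‖Δ‖ := by ring
      _ ≤ (1 + cp / m) * η * (4 * x * (kp * η + kv * η + B)) := by
          gcongr
          exact hΔ.trans (by gcongr)
      _ = _ := by ring
  have d2 : -(cp * kv / m) * inner ℝ p v ≤ cp * kv / m * (‖p‖ * ‖v‖) := by
    have := (abs_le.1 (abs_real_inner_le_norm p v)).1
    have h0 : 0 ≤ cp * kv / m := by positivity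
    nlinarith
  have d3 := hW ‖p‖ ‖v‖
  have d4 : 0 ≤ α * (cp * kp / m * ‖p‖ ^ 2 + cp * kv / m * (‖p‖ * ‖v‖) + kv * ‖v‖ ^ 2) := by
    positivity
  have e3 : cp * (inner ℝ p w + ‖v‖ ^ 2) = cp / m * inner ℝ p Δ - cp * kp / m * ‖p‖ ^ 2
      - cp * kv / m * inner ℝ p v + cp * ‖v‖ ^ 2 := by rw [e2]; field_simp
  have e4 : 2 * -(cp * kv / (2 * m) * (1 + α)) * ‖p‖ * ‖v‖
      = -(cp * kv / m * (1 + α) * (‖p‖ * ‖v‖)) := by field_simp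
  rw [e1, e3, hη]
  rw [hη] at d1
  rw [e4] at d3
  linarith

section Position

variable {P : Params} {G : Gains} {t₀ : ℝ} {T : EReal} {h : HeadingRule} {ref s : Motion}
  {d : Desired} {t : ℝ}

theorem hasDerivWithinAt_half_mul_norm_sq {f : ℝ → E3} {f' : E3} {I : Set ℝ} (c : ℝ)
    (hf : HasDerivWithinAt f f' I t) :
    HasDerivWithinAt (fun r => 1 / 2 * c * ‖f r‖ ^ 2) (c * inner ℝ (f t) f') I t := by
  refine (hf.norm_sq.const_mul (1 / 2 * c)).congr_deriv ?_
  ring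

/-- The thrust acts as the desired force up to the disturbance caused by the attitude error. -/
theorem ClosedLoop.exists_disturbance (hcl : ClosedLoop P G (timeIco t₀ T) h ref s d)
    (hkp : 0 ≤ G.kp) (hkv : 0 ≤ G.kv) {Bf : ℝ} (ht : t ∈ timeIco t₀ T)
    (hBf : ‖feedforward P ref t‖ ≤ Bf) :
    ∃ Δ : E3, P.m • (s.a t - ref.a t)
        = Δ - G.kp • (s.p t - ref.p t) - G.kv • (s.v t - ref.v t) ∧
      ‖Δ‖ ≤ 4 * ‖eX d s t‖
        * (G.kp * ‖s.p t - ref.p t‖ + G.kv * ‖s.v t - ref.v t‖ + Bf) := by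
  have hd : act (rot (d.X t : Mat2)) (basisVec 2)
      = ‖desiredForce P G ref s t‖⁻¹ • desiredForce P G ref s t := by
    rw [hcl.desired.lift t ht, hcl.desired.rotation t ht]
    exact h.act_rotation (hcl.desired.regular t ht)
  refine ⟨_, ?_, (norm_thrust_error_le (d.X t) (s.X t) hd).trans ?_⟩
  · rw [smul_sub, hcl.motion.force t ht, hcl.thrust t ht]
    nth_rewrite 3 [desiredForce]
    rw [feedforward]
    abel
  · have h1 : 2 * ‖su2Vee (relAtt (d.X t) (s.X t) : Mat2)‖ = 4 * ‖eX d s t‖ := by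
      rw [eX_eq, norm_smul, attErr, coe_relAtt]
      norm_num
      ring
    have h2 : ‖desiredForce P G ref s t‖
        ≤ G.kp * ‖s.p t - ref.p t‖ + G.kv * ‖s.v t - ref.v t‖ + Bf := by
      refine (norm_add_le _ _).trans (add_le_add ((norm_sub_le _ _).trans (add_le_add ?_ ?_)) hBf)
      · rw [norm_neg, norm_smul, Real.norm_of_nonneg hkp]
      · rw [norm_smul, Real.norm_of_nonneg hkv]
    rw [h1]
    gcongr

theorem ClosedLoop.hasDerivWithinAt_posLyap (hcl : ClosedLoop P G (timeIco t₀ T) h ref s d)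
    (ht : t ∈ timeIco t₀ T) :
    HasDerivWithinAt (posLyap P G ref s)
      (G.kp * inner ℝ (s.p t - ref.p t) (s.v t - ref.v t)
        + P.m * inner ℝ (s.v t - ref.v t) (s.a t - ref.a t)
        + G.cp * (inner ℝ (s.p t - ref.p t) (s.a t - ref.a t) + ‖s.v t - ref.v t‖ ^ 2))
      (timeIco t₀ T) t := by
  have hp := (hcl.motion.pos t ht).sub (hcl.reference.pos t ht)
  have hv := (hcl.motion.vel t ht).sub (hcl.reference.vel t ht)
  refine (((hasDerivWithinAt_half_mul_norm_sq G.kp hp).add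
    (hasDerivWithinAt_half_mul_norm_sq P.m hv)).add
    ((hp.inner ℝ hv).const_mul G.cp)).congr_deriv ?_
  rw [← real_inner_self_eq_norm_sq]
  rfl

end Position

end SU2UAV

open SU2UAV
theorem proposition2
    -- the UAV parameters
    (P : Params) (hm : 0 < P.m) (hg : 0 < P.g) (hJ : P.J.PosDef)
    -- the controller parameters and the constants of the assumptions
    (G : Gains) (φ Bf Bp : ℝ) (hBp : 0 < Bp) (hφ : φ < 1 / 8)
    (hkp : 0 < G.kp) (hkv : 0 < G.kv) (hkX : 0 < G.kX) (hkw : 0 < G.kw)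
    (hca : 0 < G.ca) (hcp : 0 < G.cp)
    -- the gain matrices of the attitude controller
    (hWaa : (Waa P G).PosDef) (hM1aa : (M1aa P G).PosDef) (hM2aa : (M2aa P G φ).PosDef)
    -- (A5)
    (hM1pp : (M1pp P G).PosDef) (hM2pp : (M2pp P G).PosDef) (hWpp : (Wpp P G φ).PosDef)
    (hBz : 0 < Bz P G φ Bf Bp) :
    -- uniform exponential stability on the domain
    ∃ C > (0 : ℝ), ∃ γ > (0 : ℝ),
      ∀ (t₀ : ℝ) (T : EReal), (t₀ : EReal) < T →
      ∀ (h : HeadingRule) (ref s : Motion) (d : Desired),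
        -- closed loop with a well-defined desired reference (A1)
        ClosedLoop P G (timeIco t₀ T) h ref s d →
        -- (A2)
        (∀ t ∈ timeIco t₀ T, ‖feedforward P ref t‖ ≤ Bf) →
        -- (A3)
        ‖s.p t₀ - ref.p t₀‖ < Bp →
        -- (A4), as part of the domain
        InDomain P G φ Bp ref s d t₀ →
        ∀ t ∈ timeIco t₀ T,
          errNorm ref s d t ≤ C * Real.exp (-γ * (t - t₀)) * errNorm ref s d t₀ := by
  have hmin := minEig_pos hJ
  have hmax : 0 < maxEig P.J := hmin.trans_le (minEig_le_maxEig hJ.1)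
  have hφ2 : 0 < 2 - φ := by linarith
  obtain ⟨wa, hwa, hWaa⟩ := exists_pos_le_form hWaa
  obtain ⟨wp, hwp, hWpp⟩ := exists_pos_le_form hWpp
  have eM1aa : M1aa P G = !![2 * G.kX, -(G.ca / 2); -(G.ca / 2), minEig P.J / 2] := by
    ext i j; fin_cases i <;> fin_cases j <;> simp [M1aa] <;> ring
  have eM1pp : M1pp P G = !![G.kp / 2, -(G.cp / 2); -(G.cp / 2), P.m / 2] := by
    ext i j; fin_cases i <;> fin_cases j <;> simp [M1pp] <;> ring
  rw [eM1aa] at hM1aa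
  rw [eM1pp] at hM1pp
  obtain ⟨μ₁, hμ₁, hM1aa⟩ := exists_pos_le_form hM1aa
  obtain ⟨ν₁, hν₁, hM1pp⟩ := exists_pos_le_form hM1pp
  obtain ⟨C, hC, γ, hγ, hcasc⟩ := exists_cascade_bound (K₁ := 4 * Bf * (1 + G.cp / P.m))
    (K₂ := 4 * (G.kp + G.kv) * (1 + G.cp / P.m)) (μ₂ := 4 * G.kX / (2 - φ) + G.ca + maxEig P.J)
    (ν₂ := G.kp + P.m + G.cp) (B := √(1 + 2 / maxEig P.J * G.kX * |φ|)) hμ₁ (by positivity)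
    hwa hν₁ (by positivity) hwp (by positivity) (by positivity)
  refine ⟨C, hC, γ, hγ, fun t₀ T hT h ref s d hcl hBf _ hD => ?_⟩
  have hgam : ∀ t ∈ timeIco t₀ T, gam (d.X t) (s.X t) ≤ φ := fun t ht =>
    hcl.gam_le hJ hkX hkw hD ht
  have hBf0 : 0 ≤ Bf := (norm_nonneg _).trans (hBf t₀ (timeIco_left_mem hT))
  have hza : ∀ t, 0 ≤ zaSq d s t := fun t => by unfold zaSq; positivity
  have hzp : ∀ t, 0 ≤ zpSq ref s t := fun t => by unfold zpSq; positivity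
  have hVa := fun t (ht : t ∈ timeIco t₀ T) =>
    hcl.exists_hasDerivWithinAt_attLyap hJ hkX.le hkw.le hca.le ht
  choose! Va' hVa hVa' using hVa
  have key := hcasc t₀ T (attLyap P G d s) Va' (posLyap P G ref s) _
    (fun t => √(zaSq d s t)) (fun t => √(zpSq ref s t)) hVa
    (fun t ht => hcl.hasDerivWithinAt_posLyap ht) (fun t _ => Real.sqrt_nonneg _) ?_ ?_ ?_ ?_ ?_
  · simpa only [Real.sq_sqrt (hza _), Real.sq_sqrt (hzp _), errNorm] using key
  · intro t ht
    simp only [Real.sq_sqrt (hza _)]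
    exact ⟨(hM1aa _ _).trans (le_attLyap hJ hkX.le hca.le d s t),
      attLyap_le hJ hkX.le hca.le (by linarith) (hgam t ht)⟩
  · intro t ht
    simp only [Real.sq_sqrt (hzp _)]
    have h1 := abs_le.1 (abs_real_inner_le_norm (s.p t - ref.p t) (s.v t - ref.v t))
    have h2 := hM1pp ‖s.p t - ref.p t‖ ‖s.v t - ref.v t‖
    have h3 := mul_le_mul_of_nonneg_left h1.1 hcp.le
    have h4 := mul_le_mul_of_nonneg_left h1.2 hcp.le
    unfold posLyap zpSq
    constructor
    · linarith
    · have h5 : ‖s.p t - ref.p t‖ * ‖s.v t - ref.v t‖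
          ≤ ‖s.p t - ref.p t‖ ^ 2 + ‖s.v t - ref.v t‖ ^ 2 := by
        nlinarith [sq_nonneg (‖s.p t - ref.p t‖ - ‖s.v t - ref.v t‖),
          sq_nonneg ‖s.p t - ref.p t‖, sq_nonneg ‖s.v t - ref.v t‖]
      have h6 := mul_le_mul_of_nonneg_left h5 hcp.le
      have p1 := mul_nonneg hkp.le (sq_nonneg ‖s.p t - ref.p t‖)
      have p2 := mul_nonneg hkp.le (sq_nonneg ‖s.v t - ref.v t‖)
      have p3 := mul_nonneg hm.le (sq_nonneg ‖s.p t - ref.p t‖)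
      have p4 := mul_nonneg hm.le (sq_nonneg ‖s.v t - ref.v t‖)
      linarith
  · intro t ht
    simp only [Real.sq_sqrt (hza _)]
    refine (hVa' t ht).trans ?_
    have := hWaa ‖eX d s t‖ ‖eW d s t‖
    unfold zaSq
    linarith
  · intro t ht
    obtain ⟨Δ, hΔ, hΔn⟩ := hcl.exists_disturbance hkp.le hkv.le ht (hBf t ht)
    have h1 := pos_dissipation (α := alpha φ) hm hkp.le hkv.le hcp.le
      (by unfold alpha; positivity) (norm_nonneg _) hWpp hΔ hΔn
      (Real.sqrt_nonneg (zpSq ref s t)) (Real.sq_sqrt (hzp t))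
    have hx : ‖eX d s t‖ ≤ √(zaSq d s t) :=
      Real.le_sqrt_of_sq_le (by unfold zaSq; nlinarith [sq_nonneg ‖eW d s t‖])
    exact h1.trans (by gcongr)
  · refine Real.sqrt_le_sqrt ?_
    have h1 := hD.rate
    have h2 := gam_mul_two_sub d s t₀
    have h3 : 2 / maxEig P.J * G.kX * (φ - gam (d.X t₀) (s.X t₀))
        ≤ 2 / maxEig P.J * G.kX * |φ| := by
      gcongr
      linarith [le_abs_self φ, gam_nonneg (d.X t₀) (s.X t₀)]
    unfold zaSq
    nlinarith [sq_nonneg (gam (d.X t₀) (s.X t₀) - 1)]
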